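/- Let $0<\alpha<1$. For $0<a<1$ let $z_a$ be the upper $a$-quantile of the standard normal distribution, and for integers $1\le X\le n-1$ put $\hat p=X/n$, $\hat q=1-\hat p$. Let $p_L=p_L(a,n,X)$ be the $a$-quantile of the $\mathrm{Beta}(X,n-X+1)$ distribution and $p_U=p_U(a,n,X)$ the $(1-a)$-quantile of the $\mathrm{Beta}(X+1,n-X)$ distribution. For $a=\alpha/2$ these are the endpoints of the two-sided $1-\alpha$ Clopper–Pearson interval, and for $a=\alpha$ they are the one-sided $1-\alpha$ Clopper–Pearson lower and upper bounds. In either case, $a\in\{\alpha/2,\alpha\}$, the following holds. (i) For all $1\le X\le n-1$, $p_L$ and $p_U$ are the unique points of $[0,1]$ with $$\sum_{k=X}^n\binom nk p_L^k(1-p_L)^{n-k}=a,\qquad \sum_{k=0}^X\binom nk p_U^k(1-p_U)^{n-k}=a .$$ (ii) As $n\to\infty$, uniformly over $X$ with $\hat p$ bounded away from $0$ and $1$, $$p_L=\hat p-n^{-1/2}z_a(\hat p\hat q)^{1/2}+(3n)^{-1}\Big(2(\tfrac12-\hat p)z_a^2-(1+\hat p)\Big)+O(n^{-3/2}),$$ $$p_U=\hat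 p+n^{-1/2}z_a(\hat p\hat q)^{1/2}+(3n)^{-1}\Big(2(\tfrac12-\hat p)z_a^2+1+\hat q\Big)+O(n^{-3/2}),$$ and, more precisely, $$p_L=\hat p-n^{-1/2}z_a(\hat p\hat q)^{1/2}+(3n)^{-1}\Big(2(\tfrac12-\hat p)z_a^2-(1+\hat p)\Big)-n^{-3/2}z_a(\hat p\hat q)^{1/2}\Big(-\tfrac{53}{36}-\tfrac{\frac12-\hat p}{\hat p}+\tfrac{z_a^2+11}{36\hat p\hat q}-\tfrac{13z_a^2}{36}\Big)+O(n^{-2}),$$ $$p_U=\hat p+n^{-1/2}z_a(\hat p\hat q)^{1/2}+(3n)^{-1}\Big(2(\tfrac12-\hat p)z_a^2+1+\hat q\Big)+n^{-3/2}z_a(\hat p\hat q)^{1/2}\Big(-\tfrac{53}{36}+\tfrac{\frac12-\hat p}{\hat q}+\tfrac{z_a^2+11}{36\hat p\hat q}-\tfrac{13z_a^2}{36}\Big)+O(n^{-2}).$$ That is, for every $\delta>0$ there is a constant $C$, depending only on $a$ and $\delta$, such that for all $1\le X\le n-1$ with $\delta\le\hat p\le1-\delta$ the four error terms are at most $Cn^{-3/2}$,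 $Cn^{-3/2}$, $Cn^{-2}$, $Cn^{-2}$ in absolute value. -/

import Mathlib

namespace ClopperPearson

/-- The `u`-quantile of a probability measure on the line: the generalised inverse of its
distribution function. -/
noncomputable def quantile (μ : MeasureTheory.Measure ℝ) (u : ℝ) : ℝ :=
  sInf {x : ℝ | u ≤ ProbabilityTheory.cdf μ x}

/-- The upper `a`-quantile `z_a` of the standard normal distribution. -/
noncomputable def zUpper (a : ℝ) : ℝ :=
  quantile (ProbabilityTheory.gaussianReal 0 1) (1 - a)

/-- The lower Clopper–Pearson limit with tail probability `a`: the `a`-quantile of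
`Beta(X, n - X + 1)`. The two-sided `1 - α` interval uses `a = α / 2`, the one-sided `1 - α`
lower bound uses `a = α`. -/
noncomputable def lower (a : ℝ) (n X : ℕ) : ℝ :=
  quantile (ProbabilityTheory.betaMeasure (X : ℝ) ((n : ℝ) - X + 1)) a

/-- The upper Clopper–Pearson limit with tail probability `a`: the `(1 - a)`-quantile of
`Beta(X + 1, n - X)`. -/
noncomputable def upper (a : ℝ) (n X : ℕ) : ℝ :=
  quantile (ProbabilityTheory.betaMeasure ((X : ℝ) + 1) ((n : ℝ) - X)) (1 - a)

/-- The probability that a `Bin(n, p)` variable is at least `X`. -/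
noncomputable def binomGE (n X : ℕ) (p : ℝ) : ℝ :=
  ∑ k ∈ Finset.Icc X n, (n.choose k : ℝ) * p ^ k * (1 - p) ^ (n - k)

/-- The probability that a `Bin(n, p)` variable is at most `X`. -/
noncomputable def binomLE (n X : ℕ) (p : ℝ) : ℝ :=
  ∑ k ∈ Finset.Icc 0 X, (n.choose k : ℝ) * p ^ k * (1 - p) ^ (n - k)

/-- Expansion of the lower limit through the `n⁻¹` term, with `p = X / n`. -/
noncomputable def lowerExp (n p z : ℝ) : ℝ :=
  p - n ^ (-(1 / 2) : ℝ) * z * (p * (1 - p)) ^ (1 / 2 : ℝ)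
    + (3 * n)⁻¹ * (2 * (1 / 2 - p) * z ^ 2 - (1 + p))

/-- Expansion of the upper limit through the `n⁻¹` term, with `p = X / n`. -/
noncomputable def upperExp (n p z : ℝ) : ℝ :=
  p + n ^ (-(1 / 2) : ℝ) * z * (p * (1 - p)) ^ (1 / 2 : ℝ)
    + (3 * n)⁻¹ * (2 * (1 / 2 - p) * z ^ 2 + (1 + (1 - p)))

/-- Expansion of the lower limit through the `n ^ (-3/2)` term, with `p = X / n`. -/
noncomputable def lowerExpRefined (n p z : ℝ) : ℝ :=
  lowerExp n p z
    - n ^ (-(3 / 2) : ℝ) * z * (p * (1 - p)) ^ (1 / 2 : ℝ)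
      * (-(53 / 36) - (1 / 2 - p) / p + (z ^ 2 + 11) / (36 * (p * (1 - p))) - 13 * z ^ 2 / 36)

/-- Expansion of the upper limit through the `n ^ (-3/2)` term, with `p = X / n`. -/
noncomputable def upperExpRefined (n p z : ℝ) : ℝ :=
  upperExp n p z
    + n ^ (-(3 / 2) : ℝ) * z * (p * (1 - p)) ^ (1 / 2 : ℝ)
      * (-(53 / 36) + (1 / 2 - p) / (1 - p) + (z ^ 2 + 11) / (36 * (p * (1 - p)))
          - 13 * z ^ 2 / 36)

end ClopperPearson

open MeasureTheory ProbabilityTheory Set Filter Topology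

/-! Binomial tails are beta distribution functions, so part (i) is strict monotonicity of `binomGE`
on the unit interval, together with the complement `binomLE_add_binomGE`.

For part (ii), put `ε = n ^ (-1/2)` and regard the refined lower expansion as a map `z ↦
approxQuantile ε p z`. In the variable `z` the beta density times the Jacobian equals `K * normalPDF
z * exp (logRatio ε p z)`, with `K` free of `z` (`density_approxQuantile`). The coefficients of the
expansion are exactly those that cancel the orders `ε` and `ε ^ 2` of `logRatio`
(`corr_first_order`, `corr_second_order`), which leaves `ε ^ 3` times polynomial growth in `z`
(`exists_abs_logRatio_le`).

Integrating over `|z| ≤ M`, where `exp (-M ^ 2 / 2) = ε ^ 4`, compares binomial and normal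
increments. Beyond `M` both tails are negligible: Chernoff on the normal side, monotonicity of the
beta density away from its mode on the other. Since the total masses are 1, `K = 1 + O(ε ^ 3)`
follows without Stirling's formula, and the binomial tail at the approximate quantile is `1 -
normalCDF z + O(ε ^ 3)`.

To invert, `z` is moved by a multiple of `ε ^ 3`, which traps the true quantile; the approximate
quantile is `O(ε)`-Lipschitz in `z`, so the error is `O(ε ^ 4) = O(n⁻²)`. The upper limit follows by
exchanging successes and failures. -/

namespace ClopperPearson

/-! ### Quantiles of continuous distributions -/

/-- A probability measure without atoms has a continuous distribution function. -/
theorem continuous_cdf_of_singleton (μ : Measure ℝ) [IsProbabilityMeasure μ]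
    (h : ∀ x, μ {x} = 0) : Continuous (cdf μ) := by
  rw [continuous_iff_continuousAt]
  intro x
  rw [(cdf μ).mono.continuousAt_iff_leftLim_eq_rightLim, (cdf μ).rightLim_eq]
  -- The mass of `{x}` is the jump of the distribution function at `x`.
  have h1 := (cdf μ).measure_singleton x
  rw [measure_cdf, h x, eq_comm, ENNReal.ofReal_eq_zero] at h1
  exact le_antisymm ((cdf μ).mono.leftLim_le le_rfl) (by linarith)

/-- The distribution function takes the value `u` at the `u`-quantile. -/
theorem cdf_quantile (μ : Measure ℝ) (hc : Continuous (cdf μ)) {u : ℝ} (h0 : 0 < u)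
    (h1 : u < 1) : cdf μ (quantile μ u) = u := by
  obtain ⟨x₀, hx₀⟩ := ((tendsto_cdf_atBot μ).eventually_lt_const h0).exists
  obtain ⟨x₁, hx₁⟩ := ((tendsto_cdf_atTop μ).eventually_const_lt h1).exists
  have hbdd : BddBelow {x : ℝ | u ≤ cdf μ x} := ⟨x₀, fun x hx => by
    by_contra! hlt
    exact absurd ((monotone_cdf μ hlt.le).trans_lt hx₀) (not_lt.mpr hx)⟩
  have hcl : IsClosed {x : ℝ | u ≤ cdf μ x} := isClosed_le continuous_const hc
  have hmem : quantile μ u ∈ {x : ℝ | u ≤ cdf μ x} := hcl.csInf_mem ⟨x₁, hx₁.le⟩ hbdd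
  refine le_antisymm ?_ hmem
  -- If the value at the infimum exceeded `u`, continuity would put a smaller point in the set.
  by_contra! hlt
  have hev : ∀ᶠ y in 𝓝[<] (quantile μ u), u < cdf μ y :=
    (hc.continuousAt.eventually_const_lt hlt).filter_mono nhdsWithin_le_nhds
  obtain ⟨y, hy, hy'⟩ := (hev.and self_mem_nhdsWithin).exists
  exact absurd (csInf_le hbdd hy.le) (not_le.mpr hy')

/-! ### Binomial tails -/

/-- The derivative of `binomGE n X` at `p` is `tailConst n X * p ^ (X - 1) * (1 - p) ^ (n - X)`. -/
noncomputable def tailConst (n X : ℕ) : ℝ := n * (n - 1).choose (X - 1)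

theorem tailConst_pos {n X : ℕ} (hX : 1 ≤ X) (hXn : X ≤ n) : 0 < tailConst n X := by
  have : 0 < (n - 1).choose (X - 1) := Nat.choose_pos (by omega)
  have : 0 < n := by omega
  unfold tailConst
  positivity

/-- The derivative of a Bernstein polynomial is a multiple of the difference of two consecutive ones
of lower degree, so the sum telescopes; the term at the far end vanishes because its index exceeds
the degree. -/
theorem hasDerivAt_binomGE {n X : ℕ} (hX : 1 ≤ X) (hXn : X ≤ n) (p : ℝ) :
    HasDerivAt (binomGE n X) (tailConst n X * (p ^ (X - 1) * (1 - p) ^ (n - X))) p := by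
  obtain ⟨Y, rfl⟩ : ∃ Y, X = Y + 1 := ⟨X - 1, by omega⟩
  obtain ⟨m, rfl⟩ : ∃ m, n = m + 1 := ⟨n - 1, by omega⟩
  have h1 : binomGE (m + 1) (Y + 1)
      = fun p => (∑ k ∈ Finset.Icc (Y + 1) (m + 1), bernsteinPolynomial ℝ (m + 1) k).eval p := by
    funext p
    simp [binomGE, Polynomial.eval_finsetSum, bernsteinPolynomial]
  have h2 : (Polynomial.derivative
      (∑ k ∈ Finset.Icc (Y + 1) (m + 1), bernsteinPolynomial ℝ (m + 1) k))
      = ((m + 1 : ℕ) : Polynomial ℝ) * bernsteinPolynomial ℝ m Y := by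
    have h3 : Finset.Icc (Y + 1) (m + 1) = Finset.Ico (Y + 1) (m + 1 + 1) := by
      ext; simp [Finset.mem_Icc, Finset.mem_Ico]
    rw [h3, ← Finset.sum_Ico_add' (fun k => bernsteinPolynomial ℝ (m + 1) k) Y (m + 1) 1,
      Polynomial.derivative_sum]
    simp only [bernsteinPolynomial.derivative_succ, Nat.add_sub_cancel]
    rw [← Finset.mul_sum]
    congr 1
    have h4 := Finset.sum_Ico_sub (fun k => bernsteinPolynomial ℝ m k) (show Y ≤ m + 1 by omega)
    rw [bernsteinPolynomial.eq_zero_of_lt ℝ (Nat.lt_succ_self m)] at h4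
    rw [← neg_inj, ← Finset.sum_neg_distrib]
    simpa using h4
  rw [h1]
  convert! (Polynomial.hasDerivAt _ p) using 1
  rw [h2]
  simp [tailConst, bernsteinPolynomial, mul_assoc]

theorem continuous_binomGE (n X : ℕ) : Continuous (binomGE n X) := by
  unfold binomGE
  fun_prop

theorem binomGE_zero {n X : ℕ} (hX : 1 ≤ X) : binomGE n X 0 = 0 := by
  refine Finset.sum_eq_zero fun k hk => ?_
  have : k ≠ 0 := by have := (Finset.mem_Icc.mp hk).1; omega
  simp [this]

theorem binomGE_one {n X : ℕ} (hXn : X ≤ n) : binomGE n X 1 = 1 := by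
  unfold binomGE
  rw [Finset.sum_eq_single n]
  · simp
  · intro k hk hkn
    have : n - k ≠ 0 := by have := (Finset.mem_Icc.mp hk).2; omega
    simp [this]
  · intro h
    exact absurd (Finset.mem_Icc.mpr ⟨hXn, le_rfl⟩) h

theorem strictMonoOn_binomGE {n X : ℕ} (hX : 1 ≤ X) (hXn : X ≤ n) :
    StrictMonoOn (binomGE n X) (Icc 0 1) := by
  refine strictMonoOn_of_deriv_pos (convex_Icc 0 1) (continuous_binomGE n X).continuousOn ?_
  intro p hp
  rw [interior_Icc] at hp
  rw [(hasDerivAt_binomGE hX hXn p).deriv]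
  have := tailConst_pos hX hXn
  have h1 : 0 < p := hp.1
  have h2 : 0 < 1 - p := by linarith [hp.2]
  positivity

theorem binomLE_add_binomGE {n X : ℕ} (hXn : X < n) (p : ℝ) :
    binomLE n X p + binomGE n (X + 1) p = 1 := by
  have h1 : Finset.Icc 0 X = Finset.Ico 0 (X + 1) := by ext; simp
  have h2 : Finset.Icc (X + 1) n = Finset.Ico (X + 1) (n + 1) := by ext; simp
  unfold binomLE binomGE
  rw [h1, h2, Finset.sum_Ico_consecutive _ (Nat.zero_le _) (by omega), ← Finset.range_eq_Ico]
  have := add_pow p (1 - p) n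
  simp only [add_sub_cancel, one_pow] at this
  refine Eq.trans (Finset.sum_congr rfl fun k _ => ?_) this.symm
  ring

theorem binomLE_eq_binomGE_one_sub {n X : ℕ} (hXn : X ≤ n) (p : ℝ) :
    binomLE n X p = binomGE n (n - X) (1 - p) := by
  unfold binomLE binomGE
  refine Finset.sum_bij' (fun k _ => n - k) (fun k _ => n - k) ?_ ?_ ?_ ?_ ?_
  · intro k hk; simp only [Finset.mem_Icc] at *; omega
  · intro k hk; simp only [Finset.mem_Icc] at *; omega
  · intro k hk; simp only [Finset.mem_Icc] at *; omega
  · intro k hk; simp only [Finset.mem_Icc] at *; omega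
  · intro k hk
    have hk' : k ≤ n := by simp only [Finset.mem_Icc] at hk; omega
    rw [Nat.choose_symm hk', Nat.sub_sub_self hk', sub_sub_cancel]
    ring

/-! ### Beta distribution functions -/

theorem continuous_cdf_betaMeasure {α β : ℝ} (hα : 0 < α) (hβ : 0 < β) :
    Continuous (cdf (betaMeasure α β)) := by
  have := isProbabilityMeasureBeta hα hβ
  refine continuous_cdf_of_singleton _ fun x => ?_
  rw [betaMeasure]
  exact (withDensity_absolutelyContinuous _ _) (by simp)

/-- The distribution function of `Beta(X, n - X + 1)` is the upper binomial tail. -/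
theorem cdf_betaMeasure_eq_binomGE {n X : ℕ} (hX : 1 ≤ X) (hXn : X ≤ n) {x : ℝ}
    (hx : x ∈ Icc (0 : ℝ) 1) :
    cdf (betaMeasure (X : ℝ) ((n : ℝ) - X + 1)) x = binomGE n X x := by
  have hXpos : (0 : ℝ) < X := by exact_mod_cast hX
  have hXn' : (X : ℝ) ≤ n := by exact_mod_cast hXn
  have hβ : (0 : ℝ) < (n : ℝ) - X + 1 := by linarith
  have hprob := isProbabilityMeasureBeta hXpos hβ
  have hb := beta_pos hXpos hβ
  set B := beta (X : ℝ) ((n : ℝ) - X + 1) with hB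
  have hc := tailConst_pos hX hXn
  -- Proportionality suffices: both sides are 1 at `y = 1`, so the constant is 1 and the beta
  -- function need not be evaluated.
  have key : ∀ y ∈ Icc (0 : ℝ) 1,
      cdf (betaMeasure (X : ℝ) ((n : ℝ) - X + 1)) y = B⁻¹ * (tailConst n X)⁻¹ * binomGE n X y := by
    intro y hy
    have hint : ∫ t in (0 : ℝ)..y, tailConst n X * (t ^ (X - 1) * (1 - t) ^ (n - X))
        = binomGE n X y := by
      rw [intervalIntegral.integral_eq_sub_of_hasDerivAt
        (fun t _ => hasDerivAt_binomGE hX hXn t)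
        ((by fun_prop : Continuous _).intervalIntegrable _ _), binomGE_zero hX, sub_zero]
    have hnn : ∀ t, 0 ≤ betaPDFReal (X : ℝ) ((n : ℝ) - X + 1) t := by
      intro t
      by_cases ht : 0 < t ∧ t < 1
      · exact (betaPDFReal_pos ht.1 ht.2 hXpos hβ).le
      · simp [betaPDFReal, ht]
    have hset : ∫ t in Iic y, betaPDFReal (X : ℝ) ((n : ℝ) - X + 1) t
        = ∫ t in (0 : ℝ)..y, B⁻¹ * (t ^ (X - 1) * (1 - t) ^ (n - X)) := by
      rw [intervalIntegral.integral_of_le hy.1]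
      rw [setIntegral_eq_of_subset_of_forall_sdiff_eq_zero (s := Ioc 0 y) measurableSet_Iic
        (fun t ht => ht.2), integral_Ioc_eq_integral_Ioo, integral_Ioc_eq_integral_Ioo]
      · refine setIntegral_congr_fun measurableSet_Ioo fun t ht => ?_
        have ht1 : t < 1 := ht.2.trans_le hy.2
        simp only [betaPDFReal, ht.1, ht1, and_self, if_true]
        rw [show (X : ℝ) - 1 = ((X - 1 : ℕ) : ℝ) by push_cast [hX]; ring,
          show (n : ℝ) - X + 1 - 1 = ((n - X : ℕ) : ℝ) by push_cast [hXn]; ring,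
          Real.rpow_natCast, Real.rpow_natCast, one_div, mul_assoc]
      · intro t ht
        have : ¬ 0 < t := fun h => ht.2 ⟨h, ht.1⟩
        simp [betaPDFReal, this]
    rw [cdf_eq_real, measureReal_def, betaMeasure, withDensity_apply _ measurableSet_Iic]
    simp only [betaPDF]
    rw [← integral_eq_lintegral_of_nonneg_ae (ae_of_all _ hnn)
      (measurable_betaPDFReal _ _).aestronglyMeasurable, hset, ← hint,
      intervalIntegral.integral_const_mul, intervalIntegral.integral_const_mul]
    field_simp
  have hone : cdf (betaMeasure (X : ℝ) ((n : ℝ) - X + 1)) 1 = 1 := by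
    have h : betaMeasure (X : ℝ) ((n : ℝ) - X + 1) (Iic 1) = 1 := by
      rw [← prob_compl_eq_zero_iff measurableSet_Iic, compl_Iic, betaMeasure,
        withDensity_apply _ measurableSet_Ioi]
      exact setLIntegral_eq_zero measurableSet_Ioi fun t ht =>
        betaPDF_eq_zero_of_one_le (le_of_lt ht)
    rw [cdf_eq_real, measureReal_def, h, ENNReal.toReal_one]
  have h1 := key 1 ⟨zero_le_one, le_rfl⟩
  rw [hone, binomGE_one hXn, mul_one] at h1
  rw [key x hx, ← h1, one_mul]

/-- A point of `[0, 1]` solves the upper tail equation exactly when it is the beta quantile. -/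
theorem binomGE_eq_iff_eq_quantile {n X : ℕ} (hX : 1 ≤ X) (hXn : X ≤ n) {u : ℝ} (h0 : 0 < u)
    (h1 : u < 1) :
    quantile (betaMeasure (X : ℝ) ((n : ℝ) - X + 1)) u ∈ Icc (0 : ℝ) 1 ∧
      ∀ p ∈ Icc (0 : ℝ) 1, (binomGE n X p = u ↔
        p = quantile (betaMeasure (X : ℝ) ((n : ℝ) - X + 1)) u) := by
  have hXpos : (0 : ℝ) < X := by exact_mod_cast hX
  have hXn' : (X : ℝ) ≤ n := by exact_mod_cast hXn
  have hq := cdf_quantile _ (continuous_cdf_betaMeasure hXpos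
    (show (0 : ℝ) < (n : ℝ) - X + 1 by linarith)) h0 h1
  set Q := quantile (betaMeasure (X : ℝ) ((n : ℝ) - X + 1)) u
  have hmem : Q ∈ Icc (0 : ℝ) 1 := by
    constructor
    · by_contra! h
      have := monotone_cdf (betaMeasure (X : ℝ) ((n : ℝ) - X + 1)) h.le
      rw [hq, cdf_betaMeasure_eq_binomGE hX hXn ⟨le_rfl, zero_le_one⟩, binomGE_zero hX] at this
      linarith
    · by_contra! h
      have := monotone_cdf (betaMeasure (X : ℝ) ((n : ℝ) - X + 1)) h.le
      rw [hq, cdf_betaMeasure_eq_binomGE hX hXn ⟨zero_le_one, le_rfl⟩, binomGE_one hXn] at this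
      linarith
  rw [cdf_betaMeasure_eq_binomGE hX hXn hmem] at hq
  refine ⟨hmem, fun p hp => ⟨fun h => ?_, fun h => h ▸ hq⟩⟩
  exact (strictMonoOn_binomGE hX hXn).injOn hp hmem (h.trans hq.symm)

/-! ### The approximate quantile map -/

/-- The standard deviation of a Bernoulli variable. -/
noncomputable def sd (p : ℝ) : ℝ := √(p * (1 - p))

/-- First-order correction of the standardized quantile. -/
noncomputable def corr₁ (p z : ℝ) : ℝ := (2 * (1 / 2 - p) * z ^ 2 - (1 + p)) / (3 * sd p)

/-- Derivative of `corr₁` in `z`. -/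
noncomputable def dcorr₁ (p z : ℝ) : ℝ := 4 * (1 / 2 - p) * z / (3 * sd p)

/-- Second-order correction of the standardized quantile. -/
noncomputable def corr₂ (p z : ℝ) : ℝ :=
  z * (53 / 36 + (1 / 2 - p) / p - (z ^ 2 + 11) / (36 * (p * (1 - p))) + 13 * z ^ 2 / 36)

/-- Derivative of `corr₂` in `z`. -/
noncomputable def dcorr₂ (p z : ℝ) : ℝ :=
  53 / 36 + (1 / 2 - p) / p - (3 * z ^ 2 + 11) / (36 * (p * (1 - p))) + 13 * (3 * z ^ 2) / 36

/-- The standardized approximate quantile, as a function of the upper normal quantile `z`. -/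
noncomputable def stdQuantile (ε p z : ℝ) : ℝ := -z + ε * corr₁ p z + ε ^ 2 * corr₂ p z

/-- `1 - ε * slope ε p z` is minus the derivative of `stdQuantile` in `z`. -/
noncomputable def slope (ε p z : ℝ) : ℝ := dcorr₁ p z + ε * dcorr₂ p z

/-- The approximate quantile, with `ε = n ^ (-1/2)`. -/
noncomputable def approxQuantile (ε p z : ℝ) : ℝ := p + sd p * ε * stdQuantile ε p z

/-- The correction of order `ε ^ 2` to the normalizing constant. -/
noncomputable def normCorr (p : ℝ) : ℝ :=
  -(1 + p) ^ 2 / (18 * (p * (1 - p))) + (1 + p) / (3 * p)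
    - (53 / 36 + (1 / 2 - p) / p - 11 / (36 * (p * (1 - p))))

/-- The logarithm of the ratio between the transformed beta density and the normal density, up to
a factor not depending on `z`. -/
noncomputable def logRatio (ε p z : ℝ) : ℝ :=
  (p * Real.log (1 + ε * (sd p / p * stdQuantile ε p z))
      + (1 - p) * Real.log (1 - ε * (sd p / (1 - p) * stdQuantile ε p z))) / ε ^ 2
    - Real.log (1 + ε * (sd p / p * stdQuantile ε p z)) + Real.log (1 - ε * slope ε p z)
    + z ^ 2 / 2 - ε ^ 2 * normCorr p

theorem sd_sq {p : ℝ} (h0 : 0 < p) (h1 : p < 1) : sd p ^ 2 = p * (1 - p) :=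
  Real.sq_sqrt (mul_pos h0 (by linarith)).le

theorem sd_pos {p : ℝ} (h0 : 0 < p) (h1 : p < 1) : 0 < sd p :=
  Real.sqrt_pos.mpr (mul_pos h0 (by linarith))

theorem hasDerivAt_stdQuantile (ε p z : ℝ) :
    HasDerivAt (stdQuantile ε p) (-(1 - ε * slope ε p z)) z := by
  have hz := hasDerivAt_id z
  have h2 := (hz.pow 2).const_mul (2 * (1 / 2 - p))
  have h1 : HasDerivAt (corr₁ p) (dcorr₁ p z) z := by
    refine ((h2.sub_const (1 + p)).div_const (3 * sd p)).congr_deriv ?_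
    simp only [dcorr₁, id]
    ring
  have h3 : HasDerivAt (corr₂ p) (dcorr₂ p z) z := by
    have h4 := ((hz.pow 2).add_const 11).div_const (36 * (p * (1 - p)))
    have h5 := ((hz.pow 2).const_mul 13).div_const 36
    refine (hz.mul ((h4.const_sub (53 / 36 + (1 / 2 - p) / p)).add h5)).congr_deriv ?_
    simp only [dcorr₂, id, Pi.add_apply, Pi.pow_apply]
    ring
  refine ((hz.neg.add (h1.const_mul ε)).add (h3.const_mul (ε ^ 2))).congr_deriv ?_
  simp only [slope]
  ring

theorem hasDerivAt_approxQuantile (ε p z : ℝ) :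
    HasDerivAt (approxQuantile ε p) (-(sd p * ε * (1 - ε * slope ε p z))) z :=
  (((hasDerivAt_stdQuantile ε p z).const_mul (sd p * ε)).const_add p).congr_deriv (by ring)

/-! ### Functions of polynomial growth, uniformly in the parameters -/

/-- `f ε p z` is bounded by a polynomial in `|z|`, uniformly for `ε ∈ (0, 1]` and
`p ∈ [δ, 1 - δ]`. -/
def PolyGrowth (δ : ℝ) (f : ℝ → ℝ → ℝ → ℝ) : Prop :=
  ∃ C : ℝ, 0 ≤ C ∧ ∃ k : ℕ, ∀ ε p z : ℝ, 0 < ε → ε ≤ 1 → p ∈ Icc δ (1 - δ) →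
    |f ε p z| ≤ C * (1 + |z|) ^ k

namespace PolyGrowth

variable {δ : ℝ} {f g : ℝ → ℝ → ℝ → ℝ}

theorem add (hf : PolyGrowth δ f) (hg : PolyGrowth δ g) :
    PolyGrowth δ (fun ε p z => f ε p z + g ε p z) := by
  obtain ⟨C, hC, k, h⟩ := hf
  obtain ⟨D, hD, l, h'⟩ := hg
  refine ⟨C + D, by positivity, max k l, fun ε p z hε hε1 hp => ?_⟩
  have hz : 1 ≤ 1 + |z| := by linarith [abs_nonneg z]
  calc |f ε p z + g ε p z| ≤ |f ε p z| + |g ε p z| := abs_add_le _ _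
    _ ≤ C * (1 + |z|) ^ k + D * (1 + |z|) ^ l := add_le_add (h ε p z hε hε1 hp) (h' ε p z hε hε1 hp)
    _ ≤ C * (1 + |z|) ^ max k l + D * (1 + |z|) ^ max k l := by
      gcongr
      · exact le_max_left _ _
      · exact le_max_right _ _
    _ = (C + D) * (1 + |z|) ^ max k l := by ring

theorem mul (hf : PolyGrowth δ f) (hg : PolyGrowth δ g) :
    PolyGrowth δ (fun ε p z => f ε p z * g ε p z) := by
  obtain ⟨C, hC, k, h⟩ := hf
  obtain ⟨D, hD, l, h'⟩ := hg
  refine ⟨C * D, by positivity, k + l, fun ε p z hε hε1 hp => ?_⟩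
  rw [abs_mul]
  calc |f ε p z| * |g ε p z| ≤ (C * (1 + |z|) ^ k) * (D * (1 + |z|) ^ l) :=
        mul_le_mul (h ε p z hε hε1 hp) (h' ε p z hε hε1 hp) (abs_nonneg _) (by positivity)
    _ = C * D * (1 + |z|) ^ (k + l) := by ring

theorem neg (hf : PolyGrowth δ f) : PolyGrowth δ (fun ε p z => -f ε p z) := by
  simpa only [PolyGrowth, abs_neg] using hf

theorem sub (hf : PolyGrowth δ f) (hg : PolyGrowth δ g) :
    PolyGrowth δ (fun ε p z => f ε p z - g ε p z) := by
  simpa only [sub_eq_add_neg] using hf.add hg.neg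

theorem abs (hf : PolyGrowth δ f) : PolyGrowth δ (fun ε p z => |f ε p z|) := by
  simpa only [PolyGrowth, abs_abs] using hf

theorem of_continuousOn {h : ℝ → ℝ} (hh : ContinuousOn h (Icc δ (1 - δ))) :
    PolyGrowth δ (fun _ p _ => h p) := by
  obtain ⟨C, hC⟩ := isCompact_Icc.exists_bound_of_continuousOn hh
  refine ⟨max C 0, le_max_right _ _, 0, fun ε p z _ _ hp => ?_⟩
  rw [pow_zero, mul_one]
  exact (hC p hp).trans (le_max_left _ _)

theorem const (c : ℝ) : PolyGrowth δ (fun _ _ _ => c) := of_continuousOn continuousOn_const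

theorem pow (hf : PolyGrowth δ f) (m : ℕ) : PolyGrowth δ (fun ε p z => f ε p z ^ m) := by
  induction m with
  | zero => simpa only [pow_zero] using const 1
  | succ m ih => simpa only [pow_succ] using ih.mul hf

theorem fst : PolyGrowth δ (fun ε _ _ => ε) :=
  ⟨1, zero_le_one, 0, fun ε p z hε hε1 _ => by rwa [pow_zero, mul_one, abs_of_pos hε]⟩

theorem trd : PolyGrowth δ (fun _ _ z => z) :=
  ⟨1, zero_le_one, 1, fun ε p z _ _ _ => by rw [pow_one, one_mul]; linarith [abs_nonneg z]⟩

end PolyGrowth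

theorem continuousOn_of_Ioo {δ : ℝ} (hδ : 0 < δ) {h : ℝ → ℝ}
    (hh : ∀ p, 0 < p → p < 1 → ContinuousAt h p) : ContinuousOn h (Icc δ (1 - δ)) :=
  fun p hp => (hh p (hδ.trans_le hp.1) (by linarith [hp.2])).continuousWithinAt

theorem continuous_sd : Continuous sd := by unfold sd; fun_prop

variable {δ : ℝ}

theorem polyGrowth_sd : PolyGrowth δ (fun _ p _ => sd p) :=
  .of_continuousOn continuous_sd.continuousOn

theorem polyGrowth_inv_sd (hδ : 0 < δ) : PolyGrowth δ (fun _ p _ => (sd p)⁻¹) :=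
  .of_continuousOn <| continuousOn_of_Ioo hδ fun _ h0 h1 =>
    continuous_sd.continuousAt.inv₀ (sd_pos h0 h1).ne'

theorem polyGrowth_inv (hδ : 0 < δ) : PolyGrowth δ (fun _ p _ => p⁻¹) :=
  .of_continuousOn <| continuousOn_of_Ioo hδ fun _ h0 _ => continuousAt_id.inv₀ h0.ne'

theorem polyGrowth_inv_one_sub (hδ : 0 < δ) : PolyGrowth δ (fun _ p _ => (1 - p)⁻¹) :=
  .of_continuousOn <| continuousOn_of_Ioo hδ fun _ _ h1 =>
    (continuousAt_const.sub continuousAt_id).inv₀ (sub_pos.mpr h1).ne'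

theorem polyGrowth_snd : PolyGrowth δ (fun _ p _ => p) := .of_continuousOn continuousOn_id

theorem polyGrowth_corr₁ (hδ : 0 < δ) : PolyGrowth δ (fun _ p z => corr₁ p z) := by
  have h := ((((PolyGrowth.const 2).mul ((PolyGrowth.const (1 / 2)).sub polyGrowth_snd)).mul
    (PolyGrowth.trd.pow 2)).sub ((PolyGrowth.const 1).add polyGrowth_snd)).mul
    ((PolyGrowth.const 3⁻¹).mul (polyGrowth_inv_sd hδ))
  simpa only [corr₁, div_eq_mul_inv, mul_inv] using h

theorem polyGrowth_dcorr₁ (hδ : 0 < δ) : PolyGrowth δ (fun _ p z => dcorr₁ p z) := by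
  have h := (((PolyGrowth.const 4).mul ((PolyGrowth.const (1 / 2)).sub polyGrowth_snd)).mul
    PolyGrowth.trd).mul ((PolyGrowth.const 3⁻¹).mul (polyGrowth_inv_sd hδ))
  simpa only [dcorr₁, div_eq_mul_inv, mul_inv] using h

theorem polyGrowth_corr₂ (hδ : 0 < δ) : PolyGrowth δ (fun _ p z => corr₂ p z) := by
  have h := PolyGrowth.trd.mul ((((PolyGrowth.const (53 / 36)).add
    (((PolyGrowth.const (1 / 2)).sub polyGrowth_snd).mul (polyGrowth_inv hδ))).sub
    (((PolyGrowth.trd.pow 2).add (PolyGrowth.const 11)).mul ((PolyGrowth.const 36⁻¹).mul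
      ((polyGrowth_inv hδ).mul (polyGrowth_inv_one_sub hδ))))).add
    (((PolyGrowth.const 13).mul (PolyGrowth.trd.pow 2)).mul (PolyGrowth.const 36⁻¹)))
  simpa only [corr₂, div_eq_mul_inv, mul_inv] using h

theorem polyGrowth_dcorr₂ (hδ : 0 < δ) : PolyGrowth δ (fun _ p z => dcorr₂ p z) := by
  have h := (((PolyGrowth.const (53 / 36)).add
    (((PolyGrowth.const (1 / 2)).sub polyGrowth_snd).mul (polyGrowth_inv hδ))).sub
    ((((PolyGrowth.const 3).mul (PolyGrowth.trd.pow 2)).add (PolyGrowth.const 11)).mul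
      ((PolyGrowth.const 36⁻¹).mul
      ((polyGrowth_inv hδ).mul (polyGrowth_inv_one_sub hδ))))).add
    (((PolyGrowth.const 13).mul ((PolyGrowth.const 3).mul (PolyGrowth.trd.pow 2))).mul
      (PolyGrowth.const 36⁻¹))
  simpa only [dcorr₂, div_eq_mul_inv, mul_inv] using h

theorem polyGrowth_stdQuantile (hδ : 0 < δ) : PolyGrowth δ stdQuantile :=
  (PolyGrowth.trd.neg.add (PolyGrowth.fst.mul (polyGrowth_corr₁ hδ))).add
    ((PolyGrowth.fst.pow 2).mul (polyGrowth_corr₂ hδ))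

theorem polyGrowth_slope (hδ : 0 < δ) : PolyGrowth δ slope :=
  (polyGrowth_dcorr₁ hδ).add (PolyGrowth.fst.mul (polyGrowth_dcorr₂ hδ))

/-! ### Expansion of the logarithm of the density ratio -/

/-- This is the coefficient of `ε` in `logRatio`. Its vanishing is an equation `z * f - f' = cubic`
for the correction, and `corr₁` is its polynomial solution. -/
theorem corr_first_order {p : ℝ} (h0 : 0 < p) (h1 : p < 1) (z : ℝ) :
    z * corr₁ p z - sd p ^ 3 * (1 / p ^ 2 - 1 / (1 - p) ^ 2) / 3 * z ^ 3 + sd p / p * z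
      - dcorr₁ p z = 0 := by
  have hs := sd_pos h0 h1
  have hq : 0 < 1 - p := by linarith
  have h3 : sd p ^ 3 * (1 / p ^ 2 - 1 / (1 - p) ^ 2) = (1 - 2 * p) / sd p := by
    rw [eq_div_iff hs.ne', mul_right_comm, ← pow_succ, show 3 + 1 = 2 * 2 by rfl, pow_mul,
      sd_sq h0 h1]
    field_simp
    ring
  have h4 : sd p / p = (1 - p) / sd p := by
    rw [div_eq_div_iff h0.ne' hs.ne', ← pow_two, sd_sq h0 h1]
    ring
  rw [h3, h4, corr₁, dcorr₁]
  field_simp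
  ring

/-- This is the coefficient of `ε ^ 2` in `logRatio`. The powers `z ^ 4`, `z ^ 2` and `1` give three
equations for the two coefficients of the odd cubic `corr₂`; `normCorr` absorbs the constant one and
goes into the normalization. -/
theorem corr_second_order {p : ℝ} (h0 : 0 < p) (h1 : p < 1) (z : ℝ) :
    z * corr₂ p z - corr₁ p z ^ 2 / 2
      + sd p ^ 3 * (1 / p ^ 2 - 1 / (1 - p) ^ 2) / 3 * (3 * z ^ 2 * corr₁ p z)
      - sd p ^ 4 * (1 / p ^ 3 + 1 / (1 - p) ^ 3) / 4 * z ^ 4 - sd p / p * corr₁ p z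
      + (sd p / p) ^ 2 / 2 * z ^ 2 - dcorr₂ p z - dcorr₁ p z ^ 2 / 2 - normCorr p = 0 := by
  have hs := sd_pos h0 h1
  have hq : 0 < 1 - p := by linarith
  have h2 := sd_sq h0 h1
  have h4 : sd p ^ 4 = (p * (1 - p)) ^ 2 := by rw [← h2]; ring
  have e1 : sd p * corr₁ p z = (2 * (1 / 2 - p) * z ^ 2 - (1 + p)) / 3 := by
    rw [corr₁]; field_simp
  have e2 : corr₁ p z ^ 2 = ((2 * (1 / 2 - p) * z ^ 2 - (1 + p)) / 3) ^ 2 / (p * (1 - p)) := by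
    rw [← h2, ← e1]; field_simp
  have e3 : dcorr₁ p z ^ 2 = (4 * (1 / 2 - p) * z / 3) ^ 2 / (p * (1 - p)) := by
    rw [← h2, dcorr₁]; field_simp
  have e4 : sd p ^ 3 * (1 / p ^ 2 - 1 / (1 - p) ^ 2) / 3 * (3 * z ^ 2 * corr₁ p z)
      = sd p ^ 2 * (1 / p ^ 2 - 1 / (1 - p) ^ 2) * z ^ 2 * (sd p * corr₁ p z) := by ring
  have e5 : sd p / p * corr₁ p z = sd p * corr₁ p z / p := by ring
  have e6 : (sd p / p) ^ 2 = (1 - p) / p := by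
    rw [div_pow, h2]; field_simp
  rw [e4, e5, e1, e2, e3, e6, h4, h2, corr₂, dcorr₂, normCorr]
  field_simp
  ring

/-- The quartic expansion serves the logarithms that are divided by `ε ^ 2` in `logRatio`, the
quadratic one those that are not. The factor 2 bounds `1 / (1 - |t|)`. -/
theorem abs_log_one_add_sub_le {t : ℝ} (ht : |t| ≤ 1 / 2) :
    |Real.log (1 + t) - (t - t ^ 2 / 2)| ≤ 2 * |t| ^ 3 ∧
    |Real.log (1 + t) - (t - t ^ 2 / 2 + t ^ 3 / 3 - t ^ 4 / 4)| ≤ 2 * |t| ^ 5 := by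
  have hlt : |-t| < 1 := by rw [abs_neg]; linarith
  have key : ∀ m : ℕ, |t| ^ m / (1 - |t|) ≤ 2 * |t| ^ m := by
    intro m
    rw [div_le_iff₀ (by linarith)]
    nlinarith [pow_nonneg (abs_nonneg t) m]
  have h2 := Real.abs_log_sub_add_sum_range_le hlt 2
  have h4 := Real.abs_log_sub_add_sum_range_le hlt 4
  rw [abs_neg] at h2 h4
  simp only [Finset.sum_range_succ, Finset.sum_range_zero, sub_neg_eq_add] at h2 h4
  push_cast at h2 h4
  constructor
  · refine le_trans (le_of_eq ?_) (h2.trans (key 3))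
    congr 1; ring
  · refine le_trans (le_of_eq ?_) (h4.trans (key 5))
    congr 1; ring

/-- The coefficient of `ε ^ 3` left over after expanding the logarithms in `logRatio`. -/
noncomputable def polyRemainder (ε p z : ℝ) : ℝ :=
  let b := corr₁ p z + ε * corr₂ p z;
  -(corr₁ p z * corr₂ p z) - ε * corr₂ p z ^ 2 / 2
    + sd p ^ 3 * (1 / p ^ 2 - 1 / (1 - p) ^ 2) / 3
      * (3 * z ^ 2 * corr₂ p z - 3 * z * b ^ 2 + ε * b ^ 3)
    - sd p ^ 4 * (1 / p ^ 3 + 1 / (1 - p) ^ 3) / 4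
      * (-(4 * z ^ 3 * b) + 6 * z ^ 2 * ε * b ^ 2 - 4 * z * ε ^ 2 * b ^ 3 + ε ^ 3 * b ^ 4)
    - sd p / p * corr₂ p z + (sd p / p) ^ 2 / 2 * (-(2 * z * b) + ε * b ^ 2)
    - (2 * dcorr₁ p z * dcorr₂ p z + ε * dcorr₂ p z ^ 2) / 2

theorem taylor_logRatio {ε p : ℝ} (hε : 0 < ε) (h0 : 0 < p) (h1 : p < 1) (z : ℝ) :
    let t := ε * (sd p / p * stdQuantile ε p z)
    let w := -(ε * (sd p / (1 - p) * stdQuantile ε p z))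
    let v := -(ε * slope ε p z)
    (p * (t - t ^ 2 / 2 + t ^ 3 / 3 - t ^ 4 / 4)
      + (1 - p) * (w - w ^ 2 / 2 + w ^ 3 / 3 - w ^ 4 / 4)) / ε ^ 2 - (t - t ^ 2 / 2)
      + (v - v ^ 2 / 2) + z ^ 2 / 2 - ε ^ 2 * normCorr p = ε ^ 3 * polyRemainder ε p z := by
  intro t w v
  have hq : 0 < 1 - p := by linarith
  have hmain : (p * (t - t ^ 2 / 2 + t ^ 3 / 3 - t ^ 4 / 4)
      + (1 - p) * (w - w ^ 2 / 2 + w ^ 3 / 3 - w ^ 4 / 4)) / ε ^ 2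
      = -(stdQuantile ε p z ^ 2 / 2)
        + ε * (sd p ^ 3 * (1 / p ^ 2 - 1 / (1 - p) ^ 2) / 3) * stdQuantile ε p z ^ 3
        - ε ^ 2 * (sd p ^ 4 * (1 / p ^ 3 + 1 / (1 - p) ^ 3) / 4) * stdQuantile ε p z ^ 4 := by
    -- The scale `sd p` makes the quadratic coefficient `sd p ^ 2 * (1 / p + 1 / (1 - p))` equal to
    -- 1; the linear terms of the two logarithms cancel.
    have hs2 : stdQuantile ε p z ^ 2 / 2
        = sd p ^ 2 * (1 / p + 1 / (1 - p)) * stdQuantile ε p z ^ 2 / 2 := by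
      rw [sd_sq h0 h1]
      field_simp
      ring
    rw [hs2]
    simp only [t, w]
    field_simp
    ring
  have o1 := corr_first_order h0 h1 z
  have o2 := corr_second_order h0 h1 z
  rw [hmain]
  simp only [t, v, polyRemainder, slope, stdQuantile]
  -- What remains is a polynomial identity in which these coefficients are opaque: orders `ε` and `ε
  -- ^ 2` are `o1` and `o2`, all higher orders make up `polyRemainder`.
  generalize sd p ^ 3 * (1 / p ^ 2 - 1 / (1 - p) ^ 2) / 3 = a₃ at *
  generalize sd p ^ 4 * (1 / p ^ 3 + 1 / (1 - p) ^ 3) / 4 = a₄ at *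
  generalize sd p / p = c at *
  linear_combination ε * o1 + ε ^ 2 * o2

theorem polyGrowth_polyRemainder (hδ : 0 < δ) : PolyGrowth δ polyRemainder := by
  have c1 := polyGrowth_corr₁ hδ
  have c2 := polyGrowth_corr₂ hδ
  have d1 := polyGrowth_dcorr₁ hδ
  have d2 := polyGrowth_dcorr₂ hδ
  have e : PolyGrowth δ (fun ε _ _ => ε) := .fst
  have z : PolyGrowth δ (fun _ _ z => z) := .trd
  have b := c1.add (e.mul c2)
  have half := PolyGrowth.const (δ := δ) (2⁻¹)
  have a3 : PolyGrowth δ (fun _ p _ => sd p ^ 3 * (1 / p ^ 2 - 1 / (1 - p) ^ 2) / 3) := by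
    have := ((polyGrowth_sd.pow 3).mul (((polyGrowth_inv hδ).pow 2).sub
      ((polyGrowth_inv_one_sub hδ).pow 2))).mul (.const 3⁻¹)
    simpa only [div_eq_mul_inv, one_mul, inv_pow] using this
  have a4 : PolyGrowth δ (fun _ p _ => sd p ^ 4 * (1 / p ^ 3 + 1 / (1 - p) ^ 3) / 4) := by
    have := ((polyGrowth_sd.pow 4).mul (((polyGrowth_inv hδ).pow 3).add
      ((polyGrowth_inv_one_sub hδ).pow 3))).mul (.const 4⁻¹)
    simpa only [div_eq_mul_inv, one_mul, inv_pow] using this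
  have c : PolyGrowth δ (fun _ p _ => sd p / p) := polyGrowth_sd.mul (polyGrowth_inv hδ)
  have n := PolyGrowth.const (δ := δ)
  exact ((((((c1.mul c2).neg.sub ((e.mul (c2.pow 2)).mul half)).add
    (a3.mul (((((n 3).mul (z.pow 2)).mul c2).sub (((n 3).mul z).mul (b.pow 2))).add
      (e.mul (b.pow 3))))).sub
    (a4.mul (((((((n 4).mul (z.pow 3)).mul b).neg).add
      ((((n 6).mul (z.pow 2)).mul e).mul (b.pow 2))).sub
      ((((n 4).mul z).mul (e.pow 2)).mul (b.pow 3))).add ((e.pow 3).mul (b.pow 4))))).sub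
    (c.mul c2)).add (((c.pow 2).mul half).mul ((((n 2).mul z).mul b).neg.add
      (e.mul (b.pow 2))))).sub
    (((((n 2).mul d1).mul d2).add (e.mul (d2.pow 2))).mul half)

/-- The logarithm of the density ratio is of order `ε ^ 3`, with polynomial growth in `z`. -/
theorem exists_abs_logRatio_le (hδ : 0 < δ) :
    ∃ C : ℝ, 0 ≤ C ∧ ∃ k : ℕ, ∀ ε p z : ℝ, 0 < ε → ε ≤ 1 → p ∈ Icc δ (1 - δ) →
      |ε * (sd p / p * stdQuantile ε p z)| ≤ 1 / 2 →
      |ε * (sd p / (1 - p) * stdQuantile ε p z)| ≤ 1 / 2 →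
      |ε * slope ε p z| ≤ 1 / 2 →
      |logRatio ε p z| ≤ ε ^ 3 * (C * (1 + |z|) ^ k) := by
  have hy : PolyGrowth δ (fun ε p z => sd p / p * stdQuantile ε p z) :=
    (polyGrowth_sd.mul (polyGrowth_inv hδ)).mul (polyGrowth_stdQuantile hδ)
  have hw : PolyGrowth δ (fun ε p z => sd p / (1 - p) * stdQuantile ε p z) :=
    (polyGrowth_sd.mul (polyGrowth_inv_one_sub hδ)).mul (polyGrowth_stdQuantile hδ)
  have hv := polyGrowth_slope hδ
  have n := PolyGrowth.const (δ := δ) 2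
  obtain ⟨C, hC, k, h⟩ := ((((polyGrowth_polyRemainder hδ).abs.add
    (n.mul (hy.abs.pow 5))).add (n.mul (hw.abs.pow 5))).add (n.mul (hy.abs.pow 3))).add
    (n.mul (hv.abs.pow 3))
  refine ⟨C, hC, k, fun ε p z hε hε1 hp h1 h2 h3 => ?_⟩
  have hp0 : 0 < p := hδ.trans_le hp.1
  have hp1 : p < 1 := by linarith [hp.2]
  refine le_trans ?_ (mul_le_mul_of_nonneg_left ((le_abs_self _).trans (h ε p z hε hε1 hp))
    (pow_pos hε 3).le)
  beta_reduce
  have ht := taylor_logRatio hε hp0 hp1 z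
  rw [← abs_neg] at h2 h3
  obtain ⟨l1, l1'⟩ := abs_log_one_add_sub_le h1
  obtain ⟨-, l2⟩ := abs_log_one_add_sub_le h2
  obtain ⟨l3, -⟩ := abs_log_one_add_sub_le h3
  simp only at ht
  rw [abs_neg] at l2 l3
  rw [abs_mul, abs_of_pos hε, mul_pow ε |_|] at l1 l1' l2 l3
  simp only [← sub_eq_add_neg] at l2 l3
  unfold logRatio
  generalize sd p / p * stdQuantile ε p z = y at *
  generalize sd p / (1 - p) * stdQuantile ε p z = w at *
  generalize slope ε p z = v at *
  set A := Real.log (1 + ε * y)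
  set B := Real.log (1 - ε * w)
  set D := Real.log (1 - ε * v)
  have hsplit : (p * A + (1 - p) * B) / ε ^ 2 - A + D + z ^ 2 / 2 - ε ^ 2 * normCorr p
      = ε ^ 3 * polyRemainder ε p z
        + (p * (A - (ε * y - (ε * y) ^ 2 / 2 + (ε * y) ^ 3 / 3 - (ε * y) ^ 4 / 4))) / ε ^ 2
        + ((1 - p) * (B - (-(ε * w) - (-(ε * w)) ^ 2 / 2 + (-(ε * w)) ^ 3 / 3
          - (-(ε * w)) ^ 4 / 4))) / ε ^ 2
        - (A - (ε * y - (ε * y) ^ 2 / 2)) + (D - (-(ε * v) - (-(ε * v)) ^ 2 / 2)) := by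
    rw [← ht]
    field_simp
    ring
  -- Division by `ε ^ 2` turns the fifth-order logarithm error into order `ε ^ 3`.
  have m1 : ∀ c r R : ℝ, 0 ≤ c → c ≤ 1 → |r| ≤ 2 * (ε ^ 5 * R) →
      |c * r / ε ^ 2| ≤ ε ^ 3 * (2 * R) := by
    intro c r R hc hc1 hr
    rw [abs_div, abs_mul, abs_of_nonneg hc, abs_of_pos (pow_pos hε 2), div_le_iff₀ (pow_pos hε 2)]
    calc c * |r| ≤ 1 * |r| := mul_le_mul_of_nonneg_right hc1 (abs_nonneg _)
      _ ≤ 2 * (ε ^ 5 * R) := by rw [one_mul]; exact hr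
      _ = _ := by ring
  have k1 := m1 p _ _ hp0.le hp1.le l1'
  have k2 := m1 (1 - p) _ _ (by linarith) (by linarith) l2
  rw [hsplit]
  have k0 : |ε ^ 3 * polyRemainder ε p z| = ε ^ 3 * |polyRemainder ε p z| := by
    rw [abs_mul, abs_of_pos (pow_pos hε 3)]
  rw [abs_le] at k1 k2 l1 l3 ⊢
  have k0' := abs_le.mp k0.le
  constructor <;> linarith [k1.1, k1.2, k2.1, k2.2, l1.1, l1.2, l3.1, l3.2, k0'.1, k0'.2]

/-! ### The standard normal distribution -/

/-- The standard normal density. -/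
noncomputable def normalPDF (z : ℝ) : ℝ := gaussianPDFReal 0 1 z

/-- The standard normal distribution function. -/
noncomputable def normalCDF (z : ℝ) : ℝ := cdf (gaussianReal 0 1) z

theorem normalPDF_eq (z : ℝ) : normalPDF z = (√(2 * Real.pi))⁻¹ * Real.exp (-z ^ 2 / 2) := by
  simp [normalPDF, gaussianPDFReal]

theorem normalPDF_pos (z : ℝ) : 0 < normalPDF z := gaussianPDFReal_pos 0 1 z one_ne_zero

theorem continuous_normalPDF : Continuous normalPDF := by
  simp only [funext normalPDF_eq]
  fun_prop

theorem normalPDF_le (z : ℝ) : normalPDF z ≤ Real.exp (-z ^ 2 / 2) := by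
  rw [normalPDF_eq]
  refine mul_le_of_le_one_left (Real.exp_pos _).le (inv_le_one_of_one_le₀ ?_)
  rw [Real.one_le_sqrt]
  linarith [Real.pi_gt_three]

theorem integral_normalPDF (a b : ℝ) : ∫ t in a..b, normalPDF t = normalCDF b - normalCDF a := by
  have hint : Integrable normalPDF := integrable_gaussianPDFReal 0 1
  have h : ∀ z, normalCDF z = ∫ t in Iic z, normalPDF t := by
    intro z
    rw [normalCDF, cdf_eq_real, measureReal_def, gaussianReal_apply_eq_integral 0 one_ne_zero,
      ENNReal.toReal_ofReal (integral_nonneg fun t => gaussianPDFReal_nonneg 0 1 t)]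
    rfl
  rw [h, h, intervalIntegral.integral_Iic_sub_Iic hint.integrableOn hint.integrableOn]

theorem normalCDF_nonneg (z : ℝ) : 0 ≤ normalCDF z := cdf_nonneg _ _

theorem normalCDF_le_one (z : ℝ) : normalCDF z ≤ 1 := cdf_le_one _ _

/-- Chernoff's bound with the optimal parameter `-M`. -/
theorem normalCDF_neg_le {M : ℝ} (hM : 0 ≤ M) : normalCDF (-M) ≤ Real.exp (-M ^ 2 / 2) := by
  have h := measure_le_le_exp_mul_mgf (μ := gaussianReal 0 1) (X := id) (t := -M) (-M)
    (by linarith) (integrable_exp_mul_gaussianReal _)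
  rw [mgf_id_gaussianReal, ← Real.exp_add] at h
  rw [normalCDF, cdf_eq_real]
  refine h.trans (le_of_eq ?_)
  congr 1
  push_cast
  ring

theorem one_sub_normalCDF_le {M : ℝ} (hM : 0 ≤ M) :
    1 - normalCDF M ≤ Real.exp (-M ^ 2 / 2) := by
  have h := measure_ge_le_exp_mul_mgf (μ := gaussianReal 0 1) (X := id) (t := M) M
    hM (integrable_exp_mul_gaussianReal _)
  rw [mgf_id_gaussianReal, ← Real.exp_add] at h
  rw [normalCDF, cdf_eq_real, ← probReal_compl_eq_one_sub measurableSet_Iic]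
  refine (measureReal_mono (fun x hx => ?_)).trans (h.trans (le_of_eq ?_))
  · simp only [mem_compl_iff, mem_Iic, not_le] at hx
    exact hx.le
  · congr 1
    push_cast
    ring

/-- A power is dominated by an exponential, and the Gaussian has all exponential moments. -/
theorem integrable_normalPDF_mul_pow (k : ℕ) :
    Integrable fun z : ℝ => normalPDF z * (1 + |z|) ^ k := by
  have h1 : Integrable (fun z : ℝ => (1 + |z|) ^ k) (gaussianReal 0 1) := by
    have hdom : Integrable (fun z : ℝ => (k.factorial * Real.exp 1)
        * (Real.exp (1 * z) + Real.exp (-1 * z))) (gaussianReal 0 1) :=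
      ((integrable_exp_mul_gaussianReal 1).add (integrable_exp_mul_gaussianReal (-1))).const_mul _
    refine hdom.mono' (by fun_prop) (ae_of_all _ fun z => ?_)
    have hz : 0 ≤ 1 + |z| := by positivity
    have h2 := Real.pow_div_factorial_le_exp (1 + |z|) hz k
    rw [div_le_iff₀ (by positivity)] at h2
    have h3 : Real.exp |z| ≤ Real.exp (1 * z) + Real.exp (-1 * z) := by
      rcases abs_cases z with h | h <;> rw [h.1]
      · rw [one_mul]; linarith [Real.exp_pos (-1 * z)]
      · rw [neg_one_mul]; linarith [Real.exp_pos (1 * z)]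
    rw [Real.norm_of_nonneg (by positivity)]
    calc (1 + |z|) ^ k ≤ Real.exp (1 + |z|) * k.factorial := h2
      _ = (k.factorial * Real.exp 1) * Real.exp |z| := by rw [Real.exp_add]; ring
      _ ≤ _ := by gcongr
  rw [gaussianReal_of_var_ne_zero 0 one_ne_zero,
    integrable_withDensity_iff_integrable_smul' (measurable_gaussianPDF _ _)
      (ae_of_all _ fun _ => gaussianPDF_lt_top)] at h1
  simpa only [toReal_gaussianPDF, smul_eq_mul] using! h1

/-! ### The cutoff -/

/-- The cutoff `M` is chosen so that `exp (-M ^ 2 / 2) = ε ^ 4`. -/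
noncomputable def cutoff (ε : ℝ) : ℝ := √(-(8 * Real.log ε))

theorem cutoff_nonneg (ε : ℝ) : 0 ≤ cutoff ε := Real.sqrt_nonneg _

theorem cutoff_sq {ε : ℝ} (h0 : 0 < ε) (h1 : ε ≤ 1) : cutoff ε ^ 2 = -(8 * Real.log ε) :=
  Real.sq_sqrt (by linarith [Real.log_nonpos h0.le h1])

theorem exp_neg_cutoff_sq {ε : ℝ} (h0 : 0 < ε) (h1 : ε ≤ 1) :
    Real.exp (-cutoff ε ^ 2 / 2) = ε ^ 4 := by
  rw [cutoff_sq h0 h1, show -(-(8 * Real.log ε)) / 2 = (4 : ℕ) * Real.log ε by push_cast; ring,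
    Real.exp_nat_mul, Real.exp_log h0]

theorem tendsto_cutoff : Tendsto cutoff (𝓝[>] 0) atTop := by
  refine Real.tendsto_sqrt_atTop.comp ?_
  refine tendsto_neg_atBot_atTop.comp ?_
  exact Real.tendsto_log_nhdsGT_zero.const_mul_atBot (by norm_num)

theorem tendsto_mul_cutoff_pow (k : ℕ) :
    Tendsto (fun ε => ε * (1 + cutoff ε) ^ k) (𝓝[>] 0) (𝓝 0) := by
  have h1 : Tendsto (fun m : ℝ => Real.exp 1 * ((1 + m) ^ k * Real.exp (-(1 + m)))) atTop
      (𝓝 0) := by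
    have := ((Real.tendsto_pow_mul_exp_neg_atTop_nhds_zero k).comp
      (tendsto_atTop_add_const_left atTop 1 tendsto_id)).const_mul (Real.exp 1)
    simpa using this
  refine squeeze_zero' ?_ ?_ (h1.comp tendsto_cutoff)
  · filter_upwards [self_mem_nhdsWithin] with ε hε
    have h : 0 < ε := hε
    have := cutoff_nonneg ε
    positivity
  · filter_upwards [Ioc_mem_nhdsGT (zero_lt_one' ℝ),
      tendsto_cutoff.eventually_ge_atTop 8] with ε hε hM
    have hsq := cutoff_sq hε.1 hε.2
    -- For `M ≥ 8` one has `M ≤ M ^ 2 / 8 = -log ε`.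
    have hle : ε ≤ Real.exp (-cutoff ε) := by
      rw [← Real.log_le_iff_le_exp hε.1]
      nlinarith
    have hpow : 0 ≤ (1 + cutoff ε) ^ k := pow_nonneg (by linarith) k
    calc ε * (1 + cutoff ε) ^ k ≤ Real.exp (-cutoff ε) * (1 + cutoff ε) ^ k := by gcongr
      _ = Real.exp 1 * ((1 + cutoff ε) ^ k * Real.exp (-(1 + cutoff ε))) := by
        rw [neg_add, Real.exp_add, Real.exp_neg 1]
        field_simp

/-- A function of polynomial growth, multiplied by `ε`, is small up to the cutoff. -/
theorem PolyGrowth.eventually_mul_le {δ : ℝ} {f : ℝ → ℝ → ℝ → ℝ} (hf : PolyGrowth δ f) {c : ℝ}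
    (hc : 0 < c) : ∀ᶠ ε in 𝓝[>] (0 : ℝ), ∀ p ∈ Icc δ (1 - δ), ∀ z, |z| ≤ cutoff ε →
      |ε * f ε p z| ≤ c := by
  obtain ⟨C, hC, k, h⟩ := hf
  have ht : Tendsto (fun ε => C * (ε * (1 + cutoff ε) ^ k)) (𝓝[>] 0) (𝓝 0) := by
    simpa using (tendsto_mul_cutoff_pow k).const_mul C
  filter_upwards [Ioc_mem_nhdsGT (zero_lt_one' ℝ), ht.eventually_le_const hc] with ε hε hle p hp z hz
  have hε0 : 0 < ε := hε.1
  rw [abs_mul, abs_of_pos hε0]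
  calc ε * |f ε p z| ≤ ε * (C * (1 + |z|) ^ k) := by gcongr; exact h ε p z hε.1 hε.2 hp
    _ ≤ ε * (C * (1 + cutoff ε) ^ k) := by gcongr
    _ = C * (ε * (1 + cutoff ε) ^ k) := by ring
    _ ≤ c := hle

/-! ### Comparison of the transformed density with the normal density -/

/-- The factor between the transformed beta density and the normal density. -/
noncomputable def densityConst (n X : ℕ) (ε p : ℝ) : ℝ :=
  tailConst n X * (sd p * ε) * √(2 * Real.pi)
    * Real.exp (((X : ℝ) - 1) * Real.log p + ((n : ℝ) - X) * Real.log (1 - p) + ε ^ 2 * normCorr p)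

theorem densityConst_pos {n X : ℕ} (hX : 1 ≤ X) (hXn : X ≤ n) {ε p : ℝ} (hε : 0 < ε)
    (h0 : 0 < p) (h1 : p < 1) : 0 < densityConst n X ε p := by
  have := tailConst_pos hX hXn
  have := sd_pos h0 h1
  have := Real.pi_pos
  unfold densityConst
  positivity

theorem approxQuantile_eq_mul {p : ℝ} (h0 : 0 < p) (ε z : ℝ) :
    approxQuantile ε p z = p * (1 + ε * (sd p / p * stdQuantile ε p z)) := by
  rw [approxQuantile]
  field_simp

theorem one_sub_approxQuantile_eq_mul {p : ℝ} (h1 : p < 1) (ε z : ℝ) :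
    1 - approxQuantile ε p z = (1 - p) * (1 - ε * (sd p / (1 - p) * stdQuantile ε p z)) := by
  have : 1 - p ≠ 0 := by linarith
  rw [approxQuantile]
  field_simp
  ring

/-- Change of variables. With `n = 1 / ε ^ 2` and `X = p * n`, the exponents `X - 1` and `n - X`
produce the logarithms in `logRatio`, the `-1` giving the one not divided by `ε ^ 2`; the Jacobian
gives the `slope` term. -/
theorem density_approxQuantile {n X : ℕ} (hX : 1 ≤ X) (hXn : X ≤ n) {ε p z : ℝ} (hε : 0 < ε)
    (h0 : 0 < p) (h1 : p < 1) (hn : ε ^ 2 * n = 1) (hp : p * n = X)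
    (hy : 0 < 1 + ε * (sd p / p * stdQuantile ε p z))
    (hw : 0 < 1 - ε * (sd p / (1 - p) * stdQuantile ε p z))
    (hv : 0 < 1 - ε * slope ε p z) :
    tailConst n X * (approxQuantile ε p z ^ (X - 1) * (1 - approxQuantile ε p z) ^ (n - X))
        * (sd p * ε * (1 - ε * slope ε p z))
      = densityConst n X ε p * (normalPDF z * Real.exp (logRatio ε p z)) := by
  have hq : 0 < 1 - p := by linarith
  have e1 : approxQuantile ε p z ^ (X - 1) = Real.exp (((X : ℝ) - 1)
      * (Real.log p + Real.log (1 + ε * (sd p / p * stdQuantile ε p z)))) := by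
    rw [approxQuantile_eq_mul h0, ← Real.log_mul h0.ne' hy.ne',
      show (X : ℝ) - 1 = ((X - 1 : ℕ) : ℝ) by push_cast [hX]; ring, Real.exp_nat_mul,
      Real.exp_log (mul_pos h0 hy)]
  have e2 : (1 - approxQuantile ε p z) ^ (n - X) = Real.exp (((n : ℝ) - X)
      * (Real.log (1 - p) + Real.log (1 - ε * (sd p / (1 - p) * stdQuantile ε p z)))) := by
    rw [one_sub_approxQuantile_eq_mul h1, ← Real.log_mul hq.ne' hw.ne',
      show (n : ℝ) - X = ((n - X : ℕ) : ℝ) by push_cast [hXn]; ring, Real.exp_nat_mul,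
      Real.exp_log (mul_pos hq hw)]
  have hn' : (n : ℝ) = 1 / ε ^ 2 := by field_simp; linarith
  have hpi : √(2 * Real.pi) ≠ 0 := by have := Real.pi_pos; positivity
  have hexp : ((X : ℝ) - 1) * (Real.log p + Real.log (1 + ε * (sd p / p * stdQuantile ε p z)))
      + ((n : ℝ) - X)
        * (Real.log (1 - p) + Real.log (1 - ε * (sd p / (1 - p) * stdQuantile ε p z)))
      + Real.log (1 - ε * slope ε p z)
      = (((X : ℝ) - 1) * Real.log p + ((n : ℝ) - X) * Real.log (1 - p) + ε ^ 2 * normCorr p)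
        + -z ^ 2 / 2 + logRatio ε p z := by
    rw [← hp, hn', logRatio]
    ring
  calc _ = tailConst n X * (sd p * ε) * (Real.exp (((X : ℝ) - 1)
        * (Real.log p + Real.log (1 + ε * (sd p / p * stdQuantile ε p z))))
        * Real.exp (((n : ℝ) - X)
        * (Real.log (1 - p) + Real.log (1 - ε * (sd p / (1 - p) * stdQuantile ε p z))))
        * Real.exp (Real.log (1 - ε * slope ε p z))) := by
        rw [e1, e2, Real.exp_log hv]; ring
    _ = _ := by
        rw [← Real.exp_add, ← Real.exp_add, hexp, Real.exp_add, Real.exp_add, densityConst,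
          normalPDF_eq]
        field_simp

theorem continuous_approxQuantile (ε p : ℝ) : Continuous (approxQuantile ε p) :=
  continuous_iff_continuousAt.mpr fun z => (hasDerivAt_approxQuantile ε p z).continuousAt

theorem continuous_slope (ε p : ℝ) : Continuous (slope ε p) := by
  unfold slope dcorr₁ dcorr₂
  fun_prop

/-- The left side of `hdens` is minus the derivative of the binomial tail along the approximate
quantile. Integrating it, with `|exp L - 1| ≤ 2 * |L|` for `|L| ≤ 1`, leaves a Gaussian moment. -/
theorem abs_binomGE_increment_sub_le {n X : ℕ} (hX : 1 ≤ X) (hXn : X ≤ n) {ε p K D a b : ℝ}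
    {k : ℕ} (hab : a ≤ b) (hK : 0 ≤ K) (hD : 0 ≤ D)
    (hdens : ∀ z ∈ Icc a b, tailConst n X
      * (approxQuantile ε p z ^ (X - 1) * (1 - approxQuantile ε p z) ^ (n - X))
      * (sd p * ε * (1 - ε * slope ε p z)) = K * (normalPDF z * Real.exp (logRatio ε p z)))
    (hL : ∀ z ∈ Icc a b, |logRatio ε p z| ≤ D * (1 + |z|) ^ k)
    (hL1 : ∀ z ∈ Icc a b, |logRatio ε p z| ≤ 1) :
    |binomGE n X (approxQuantile ε p a) - binomGE n X (approxQuantile ε p b)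
      - K * (normalCDF b - normalCDF a)|
      ≤ K * (2 * D * ∫ z, normalPDF z * (1 + |z|) ^ k) := by
  set g : ℝ → ℝ := fun z => tailConst n X
      * (approxQuantile ε p z ^ (X - 1) * (1 - approxQuantile ε p z) ^ (n - X))
      * (sd p * ε * (1 - ε * slope ε p z)) with hg
  have hcont : Continuous g := by
    have := continuous_approxQuantile ε p
    have := continuous_slope ε p
    fun_prop
  have hI : ∫ z in a..b, g z
      = binomGE n X (approxQuantile ε p a) - binomGE n X (approxQuantile ε p b) := by
    have hder : ∀ z ∈ uIcc a b,
        HasDerivAt (fun z => -binomGE n X (approxQuantile ε p z)) (g z) z := fun z _ =>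
      (((hasDerivAt_binomGE hX hXn _).comp z (hasDerivAt_approxQuantile ε p z)).neg).congr_deriv
        (by simp only [hg]; ring)
    rw [intervalIntegral.integral_eq_sub_of_hasDerivAt hder (hcont.intervalIntegrable _ _)]
    ring
  have hmom := integrable_normalPDF_mul_pow k
  rw [← hI, ← integral_normalPDF, ← intervalIntegral.integral_const_mul,
    ← intervalIntegral.integral_sub (hcont.intervalIntegrable _ _)
      ((continuous_normalPDF.const_mul K).intervalIntegrable _ _), ← Real.norm_eq_abs]
  refine (intervalIntegral.norm_integral_le_of_norm_le hab (g := fun z =>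
    (K * (2 * D)) * (normalPDF z * (1 + |z|) ^ k)) (ae_of_all _ fun z hz => ?_)
    (hmom.const_mul _).intervalIntegrable).trans ?_
  · have hz' : z ∈ Icc a b := ⟨hz.1.le, hz.2⟩
    have hφ := normalPDF_pos z
    have hexp : |Real.exp (logRatio ε p z) - 1| ≤ 2 * |logRatio ε p z| :=
      Real.abs_exp_sub_one_le (hL1 z hz')
    rw [Real.norm_eq_abs, show g z = _ from hdens z hz',
      show K * (normalPDF z * Real.exp (logRatio ε p z)) - K * normalPDF z
        = K * normalPDF z * (Real.exp (logRatio ε p z) - 1) by ring, abs_mul,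
      abs_of_nonneg (mul_nonneg hK hφ.le)]
    calc K * normalPDF z * |Real.exp (logRatio ε p z) - 1|
        ≤ K * normalPDF z * (2 * (D * (1 + |z|) ^ k)) := by
          have := hL z hz'
          gcongr
          linarith
      _ = _ := by ring
  · rw [intervalIntegral.integral_const_mul, mul_assoc]
    have h : ∫ z in a..b, normalPDF z * (1 + |z|) ^ k ≤ ∫ z, normalPDF z * (1 + |z|) ^ k := by
      rw [intervalIntegral.integral_of_le hab]
      exact setIntegral_le_integral hmom (ae_of_all _ fun z =>
        mul_nonneg (normalPDF_pos z).le (by positivity))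
    gcongr

/-! ### Tails of the beta distribution -/

/-- The hypothesis `h` says that `t` does not lie on the same side of `x` as the mode `a / (a + b)`.
Applying `r ≤ exp (r - 1)` to `t / x` and `(1 - t) / (1 - x)` gives an exponent with the sign of
`h`. -/
theorem pow_mul_one_sub_pow_le {a b : ℕ} {t x : ℝ} (ht0 : 0 ≤ t) (ht1 : t ≤ 1) (hx0 : 0 < x)
    (hx1 : x < 1) (h : (t - x) * (a * (1 - x) - b * x) ≤ 0) :
    t ^ a * (1 - t) ^ b ≤ x ^ a * (1 - x) ^ b := by
  have hx1' : 0 < 1 - x := by linarith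
  have h1 : (t / x) ^ a ≤ Real.exp (a * (t / x - 1)) := by
    rw [Real.exp_nat_mul]
    exact pow_le_pow_left₀ (by positivity) (by linarith [Real.add_one_le_exp (t / x - 1)]) a
  have h2 : ((1 - t) / (1 - x)) ^ b ≤ Real.exp (b * ((1 - t) / (1 - x) - 1)) := by
    rw [Real.exp_nat_mul]
    exact pow_le_pow_left₀ (div_nonneg (by linarith) hx1'.le)
      (by linarith [Real.add_one_le_exp ((1 - t) / (1 - x) - 1)]) b
  have h3 : (t / x) ^ a * ((1 - t) / (1 - x)) ^ b ≤ 1 := by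
    refine (mul_le_mul h1 h2 (pow_nonneg (div_nonneg (by linarith) hx1'.le) b)
      (Real.exp_pos _).le).trans ?_
    rw [← Real.exp_add, Real.exp_le_one_iff]
    have : (a : ℝ) * (t / x - 1) + b * ((1 - t) / (1 - x) - 1)
        = ((t - x) * (a * (1 - x) - b * x)) / (x * (1 - x)) := by
      field_simp
      ring
    rw [this]
    exact div_nonpos_of_nonpos_of_nonneg h (by positivity)
  rw [div_pow, div_pow, div_mul_div_comm, div_le_one (by positivity)] at h3
  exact h3

/-- Mean value theorem on `[0, x]`: left of the mode the density at the intermediate point is at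
most that at `x`, and the length `x` is below 1. -/
theorem binomGE_le_density {n X : ℕ} (hX : 1 ≤ X) (hXn : X ≤ n) {x : ℝ} (hx0 : 0 < x)
    (hx1 : x < 1) (h : ((n : ℝ) - 1) * x ≤ X - 1) :
    binomGE n X x ≤ tailConst n X * (x ^ (X - 1) * (1 - x) ^ (n - X)) := by
  have hc := tailConst_pos hX hXn
  obtain ⟨t, ht, hslope⟩ := exists_hasDerivAt_eq_slope (binomGE n X) _ hx0
    (continuous_binomGE n X).continuousOn (fun t _ => hasDerivAt_binomGE hX hXn t)
  rw [binomGE_zero hX, sub_zero, sub_zero, eq_div_iff hx0.ne'] at hslope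
  rw [← hslope]
  have hx1' : 0 < 1 - x := by linarith
  refine (mul_le_of_le_one_right ?_ hx1.le).trans (mul_le_mul_of_nonneg_left
    (pow_mul_one_sub_pow_le ht.1.le (ht.2.trans hx1).le hx0 hx1 ?_) hc.le)
  · have := ht.1
    have : 0 < 1 - t := by linarith [ht.2]
    positivity
  · push_cast [hX, hXn]
    have := ht.2
    exact mul_nonpos_of_nonpos_of_nonneg (by linarith) (by linarith)

theorem one_sub_binomGE_le_density {n X : ℕ} (hX : 1 ≤ X) (hXn : X ≤ n) {x : ℝ} (hx0 : 0 < x)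
    (hx1 : x < 1) (h : (X : ℝ) - 1 ≤ ((n : ℝ) - 1) * x) :
    1 - binomGE n X x ≤ tailConst n X * (x ^ (X - 1) * (1 - x) ^ (n - X)) := by
  have hc := tailConst_pos hX hXn
  obtain ⟨t, ht, hslope⟩ := exists_hasDerivAt_eq_slope (binomGE n X) _ hx1
    (continuous_binomGE n X).continuousOn (fun t _ => hasDerivAt_binomGE hX hXn t)
  have hx1' : 0 < 1 - x := by linarith
  rw [binomGE_one hXn, eq_div_iff hx1'.ne'] at hslope
  rw [← hslope]
  refine (mul_le_of_le_one_right ?_ (by linarith)).trans (mul_le_mul_of_nonneg_left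
    (pow_mul_one_sub_pow_le (hx0.trans ht.1).le ht.2.le hx0 hx1 ?_) hc.le)
  · have := hx0.trans ht.1
    have : 0 < 1 - t := by linarith [ht.2]
    positivity
  · push_cast [hX, hXn]
    have := ht.1
    exact mul_nonpos_of_nonneg_of_nonpos (by linarith) (by linarith)

/-! ### The normal approximation -/

/-- Adding `hl` and `hr` eliminates `G` and `Φ` and gives `|K - 1| ≤ 6 * K * η`: two units each from
the increments, the binomial tails and the normal tails. Smallness of `η` then gives `K ≤ 2`, and
`hr` alone yields the claim. -/
theorem abs_sub_le_of_relative_bounds {K η A B G Φ Φ₀ Φ₁ : ℝ} (hK : 0 < K) (hη : η ≤ 1 / 16)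
    (hη0 : 0 ≤ η)
    (hA0 : 0 ≤ A) (hA : A ≤ K * η) (hB0 : 0 ≤ B) (hB : B ≤ K * η)
    (hΦ0 : 0 ≤ Φ) (hΦ1 : Φ ≤ 1) (h0 : 0 ≤ Φ₀) (h0' : Φ₀ ≤ η) (h1 : Φ₁ ≤ 1) (h1' : 1 - Φ₁ ≤ η)
    (hl : |(1 - B) - G - K * (Φ - Φ₀)| ≤ K * η) (hr : |G - A - K * (Φ₁ - Φ)| ≤ K * η) :
    |G - (1 - Φ)| ≤ 18 * η := by
  rw [abs_le] at hl hr
  have hm0 := mul_le_mul_of_nonneg_left h0' hK.le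
  have hm1 := mul_le_mul_of_nonneg_left h1' hK.le
  have hm0' := mul_nonneg hK.le h0
  have hm1' := mul_le_mul_of_nonneg_left h1 hK.le
  have hKη := mul_le_mul_of_nonneg_left hη hK.le
  have hK1 : |K - 1| ≤ 6 * (K * η) := abs_le.mpr ⟨by linarith, by linarith⟩
  have hK2 : K ≤ 2 := by linarith [(abs_le.mp hK1).2]
  have hKη2 : K * η ≤ 2 * η := mul_le_mul_of_nonneg_right hK2 hη0
  have hprod : |(K - 1) * (1 - Φ)| ≤ 6 * (K * η) := by
    rw [abs_mul, abs_of_nonneg (show 0 ≤ 1 - Φ by linarith)]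
    exact (mul_le_of_le_one_right (abs_nonneg _) (by linarith)).trans hK1
  rw [abs_le] at hprod ⊢
  constructor <;> nlinarith [hprod.1, hprod.2]

theorem le_sd {δ p : ℝ} (hδ : 0 < δ) (hp : p ∈ Icc δ (1 - δ)) : δ ≤ sd p := by
  refine Real.le_sqrt_of_sq_le ?_
  have h1 : δ ≤ 1 - p := by linarith [hp.2]
  rw [sq]
  exact mul_le_mul hp.1 h1 hδ.le (hδ.le.trans hp.1)

/-- At the approximate quantile the upper binomial tail agrees with the upper normal tail up to
an error of order `ε ^ 3`. -/
theorem exists_abs_binomGE_approxQuantile_sub_le {δ : ℝ} (hδ : 0 < δ) :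
    ∃ C : ℝ, 0 < C ∧ ∀ᶠ ε : ℝ in 𝓝[>] 0, ∀ n X : ℕ, 1 ≤ X → X < n → ε ^ 2 * n = 1 →
      (X : ℝ) / n ∈ Icc δ (1 - δ) → ∀ z, |z| ≤ cutoff ε →
      approxQuantile ε ((X : ℝ) / n) z ∈ Icc (0 : ℝ) 1 ∧
      |binomGE n X (approxQuantile ε ((X : ℝ) / n) z) - (1 - normalCDF z)| ≤ C * ε ^ 3 := by
  obtain ⟨C₀, hC₀, k, hL⟩ := exists_abs_logRatio_le hδ
  set I := ∫ z, normalPDF z * (1 + |z|) ^ k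
  have hI : 0 ≤ I := integral_nonneg fun z => mul_nonneg (normalPDF_pos z).le (by positivity)
  -- The summands pay for the increments, the binomial tails, and `ε ^ 4 ≤ D * ε ^ 3` in the normal
  -- tails.
  set D := 2 * C₀ * I + 6 / δ + 1 with hD
  have hDpos : 0 < D := by positivity
  have hy : PolyGrowth δ (fun ε p z => sd p / p * stdQuantile ε p z) :=
    (polyGrowth_sd.mul (polyGrowth_inv hδ)).mul (polyGrowth_stdQuantile hδ)
  have hw : PolyGrowth δ (fun ε p z => sd p / (1 - p) * stdQuantile ε p z) :=
    (polyGrowth_sd.mul (polyGrowth_inv_one_sub hδ)).mul (polyGrowth_stdQuantile hδ)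
  have hc : PolyGrowth δ (fun ε p z => corr₁ p z + ε * corr₂ p z) :=
    (polyGrowth_corr₁ hδ).add (PolyGrowth.fst.mul (polyGrowth_corr₂ hδ))
  have hr : PolyGrowth δ (fun _ _ z => C₀ * (1 + |z|) ^ k) :=
    (PolyGrowth.const C₀).mul (((PolyGrowth.const 1).add PolyGrowth.trd.abs).pow k)
  have hη : Tendsto (fun ε : ℝ => D * ε ^ 3) (𝓝[>] 0) (𝓝 0) := by
    have : Tendsto (fun ε : ℝ => D * ε ^ 3) (𝓝 0) (𝓝 (D * 0 ^ 3)) :=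
      (by fun_prop : Continuous fun ε : ℝ => D * ε ^ 3).tendsto 0
    simpa using this.mono_left nhdsWithin_le_nhds
  refine ⟨18 * D, by positivity, ?_⟩
  filter_upwards [Ioc_mem_nhdsGT (zero_lt_one' ℝ),
    hη.eventually_le_const (show (0 : ℝ) < 1 / 16 by norm_num),
    tendsto_cutoff.eventually_ge_atTop (1 + 2 / δ),
    hy.eventually_mul_le (show (0 : ℝ) < 1 / 2 by norm_num),
    hw.eventually_mul_le (show (0 : ℝ) < 1 / 2 by norm_num),
    (polyGrowth_slope hδ).eventually_mul_le (show (0 : ℝ) < 1 / 2 by norm_num),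
    hc.eventually_mul_le one_pos, hr.eventually_mul_le one_pos]
    with ε hε hη hM hy hw hv hc hr n X hX hXn hn hp z hz
  set p : ℝ := (X : ℝ) / n with hpdef
  set M := cutoff ε with hMdef
  have hε0 : 0 < ε := hε.1
  have hp0 : 0 < p := hδ.trans_le hp.1
  have hp1 : p < 1 := by linarith [hp.2]
  have hn0 : (0 : ℝ) < n := by exact_mod_cast (by omega : 0 < n)
  have hn2 : (2 : ℝ) ≤ n := by exact_mod_cast (by omega : 2 ≤ n)
  have hpn : p * n = X := by rw [hpdef]; field_simp
  have hs := le_sd hδ hp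
  have hsε : 0 ≤ sd p * ε := mul_nonneg (hδ.le.trans hs) hε0.le
  have hM0 : 0 ≤ M := cutoff_nonneg ε
  have hK := densityConst_pos hX hXn.le hε0 hp0 hp1
  set K := densityConst n X ε p
  have hy' : ∀ z, |z| ≤ M → 0 < 1 + ε * (sd p / p * stdQuantile ε p z) := fun z hz => by
    linarith [(abs_le.mp (hy p hp z hz)).1]
  have hw' : ∀ z, |z| ≤ M → 0 < 1 - ε * (sd p / (1 - p) * stdQuantile ε p z) := fun z hz => by
    linarith [(abs_le.mp (hw p hp z hz)).2]
  have hv' : ∀ z, |z| ≤ M → 1 / 2 ≤ 1 - ε * slope ε p z := fun z hz => by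
    linarith [(abs_le.mp (hv p hp z hz)).2]
  have hx0 : ∀ z, |z| ≤ M → 0 < approxQuantile ε p z := fun z hz => by
    rw [approxQuantile_eq_mul hp0]
    exact mul_pos hp0 (hy' z hz)
  have hx1 : ∀ z, |z| ≤ M → approxQuantile ε p z < 1 := fun z hz => by
    rw [← sub_pos, one_sub_approxQuantile_eq_mul hp1]
    exact mul_pos (by linarith) (hw' z hz)
  have hdens : ∀ z, |z| ≤ M → tailConst n X
      * (approxQuantile ε p z ^ (X - 1) * (1 - approxQuantile ε p z) ^ (n - X))
      * (sd p * ε * (1 - ε * slope ε p z)) = K * (normalPDF z * Real.exp (logRatio ε p z)) :=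
    fun z hz => density_approxQuantile hX hXn.le hε0 hp0 hp1 hn hpn (hy' z hz) (hw' z hz)
      (by linarith [hv' z hz])
  have hL' : ∀ z, |z| ≤ M → |logRatio ε p z| ≤ ε ^ 3 * C₀ * (1 + |z|) ^ k := fun z hz => by
    rw [mul_assoc]
    exact hL ε p z hε0 hε.2 hp (hy p hp z hz) (hw p hp z hz) (hv p hp z hz)
  have hL1 : ∀ z, |z| ≤ M → |logRatio ε p z| ≤ 1 := fun z hz => by
    have h1 := (le_abs_self _).trans (hr p hp z hz)
    refine (hL' z hz).trans ?_
    rw [mul_assoc]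
    refine (mul_le_mul_of_nonneg_right (?_ : ε ^ 3 ≤ ε) (by positivity)).trans h1
    exact pow_le_of_le_one hε0.le hε.2 (by norm_num)
  -- Dividing by the Jacobian, which is at least `δ * ε / 2`, costs one power of `ε`; hence a cutoff
  -- at `ε ^ 4`. The factor 6 is `3 * 2`, with `exp 1 ≤ 3`.
  have htail : ∀ z, |z| ≤ M → normalPDF z ≤ ε ^ 4 → tailConst n X
      * (approxQuantile ε p z ^ (X - 1) * (1 - approxQuantile ε p z) ^ (n - X))
      ≤ K * (D * ε ^ 3) := by
    intro z hz hφ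
    have hexp : Real.exp (logRatio ε p z) ≤ 3 :=
      (Real.exp_le_exp.mpr ((le_abs_self _).trans (hL1 z hz))).trans
        (by linarith [Real.exp_one_lt_d9])
    have hnum : K * (normalPDF z * Real.exp (logRatio ε p z)) ≤ K * (ε ^ 4 * 3) := by
      gcongr
    have hden : δ * ε * (1 / 2) ≤ sd p * ε * (1 - ε * slope ε p z) := by
      have := hv' z hz
      gcongr
    have hdpos : 0 < δ * ε * (1 / 2) := by positivity
    rw [← hdens z hz, ← le_div_iff₀ (hdpos.trans_le hden)] at hnum
    refine hnum.trans ?_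
    calc K * (ε ^ 4 * 3) / (sd p * ε * (1 - ε * slope ε p z))
        ≤ K * (ε ^ 4 * 3) / (δ * ε * (1 / 2)) := by gcongr
      _ = K * (6 / δ * ε ^ 3) := by field_simp; ring
      _ ≤ K * (D * ε ^ 3) := by
        have : 6 / δ ≤ D := by
          have : 0 ≤ 2 * C₀ * I := by positivity
          linarith
        gcongr
  have hmM : |M| ≤ M := (abs_of_nonneg hM0).le
  have hmM' : |(-M)| ≤ M := by rw [abs_neg]; exact hmM
  have hε4 : ε ^ 4 ≤ D * ε ^ 3 := by
    rw [pow_succ']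
    gcongr
    have : 0 ≤ 2 * C₀ * I + 6 / δ := by positivity
    linarith [hε.2]
  have hexpM : Real.exp (-M ^ 2 / 2) = ε ^ 4 := exp_neg_cutoff_sq hε0 hε.2
  have hφM : normalPDF M ≤ ε ^ 4 := (normalPDF_le M).trans hexpM.le
  have hφM' : normalPDF (-M) ≤ ε ^ 4 := by
    refine (normalPDF_le (-M)).trans ?_
    rw [neg_sq]
    exact hexpM.le
  -- The mode `(X - 1) / (n - 1) = p - (1 - p) / (n - 1)` lies in `[p - 2 * ε ^ 2, p]` since `n ≥
  -- 2`. So `hxM` and `hxM'` place the two endpoints on opposite sides of it, as the tail bounds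
  -- require.
  have hsd : 2 * ε ^ 2 ≤ sd p * ε * (M - 1) := by
    have h1 : 2 ≤ δ * (M - 1) := by
      have : 2 / δ ≤ M - 1 := by linarith
      rwa [div_le_iff₀' hδ] at this
    have h2 : 0 ≤ M - 1 := by
      have : 0 < 2 / δ := by positivity
      linarith
    calc 2 * ε ^ 2 ≤ 2 * ε := by
          have := pow_le_of_le_one hε0.le hε.2 (show 2 ≠ 0 by norm_num)
          linarith
      _ ≤ δ * (M - 1) * ε := by gcongr
      _ ≤ sd p * (M - 1) * ε := by gcongr
      _ = _ := by ring
  have hstd : ∀ z, stdQuantile ε p z = -z + ε * (corr₁ p z + ε * corr₂ p z) := fun z => by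
    rw [stdQuantile]; ring
  have hxM : approxQuantile ε p M ≤ p - 2 * ε ^ 2 := by
    have h1 : stdQuantile ε p M ≤ -(M - 1) := by
      rw [hstd]; linarith [(abs_le.mp (hc p hp M hmM)).2]
    have h2 := mul_le_mul_of_nonneg_left h1 hsε
    rw [approxQuantile]
    linarith
  have hxM' : p ≤ approxQuantile ε p (-M) := by
    have h1 : M - 1 ≤ stdQuantile ε p (-M) := by
      rw [hstd]; linarith [(abs_le.mp (hc p hp (-M) hmM')).1]
    have h2 := mul_le_mul_of_nonneg_left h1 hsε
    have h3 : 0 < ε ^ 2 := by positivity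
    rw [approxQuantile]
    linarith
  have hn1 : (0 : ℝ) ≤ (n : ℝ) - 1 := by linarith
  have hA : binomGE n X (approxQuantile ε p M) ≤ K * (D * ε ^ 3) := by
    refine (binomGE_le_density hX hXn.le (hx0 M hmM) (hx1 M hmM) ?_).trans (htail M hmM hφM)
    have h1 := mul_le_mul_of_nonneg_left hxM hn1
    have h3 := pow_le_one₀ hε0.le hε.2 (n := 2)
    have h4 : ε ^ 2 * 2 ≤ ε ^ 2 * n := by gcongr
    linarith
  have hB : 1 - binomGE n X (approxQuantile ε p (-M)) ≤ K * (D * ε ^ 3) := by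
    refine (one_sub_binomGE_le_density hX hXn.le (hx0 _ hmM') (hx1 _ hmM') ?_).trans
      (htail _ hmM' hφM')
    have h1 := mul_le_mul_of_nonneg_left hxM' hn1
    linarith
  have hmono := (strictMonoOn_binomGE hX hXn.le).monotoneOn
  have hA0 : 0 ≤ binomGE n X (approxQuantile ε p M) := by
    rw [← binomGE_zero hX (n := n)]
    exact hmono ⟨le_rfl, zero_le_one⟩ ⟨(hx0 M hmM).le, (hx1 M hmM).le⟩ (hx0 M hmM).le
  have hB0 : 0 ≤ 1 - binomGE n X (approxQuantile ε p (-M)) := by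
    rw [← binomGE_one hXn.le, sub_nonneg]
    exact hmono ⟨(hx0 _ hmM').le, (hx1 _ hmM').le⟩ ⟨zero_le_one, le_rfl⟩ (hx1 _ hmM').le
  have hincr : ∀ a b, -M ≤ a → a ≤ b → b ≤ M →
      |binomGE n X (approxQuantile ε p a) - binomGE n X (approxQuantile ε p b)
        - K * (normalCDF b - normalCDF a)| ≤ K * (D * ε ^ 3) := by
    intro a b ha hab hb
    have hmem : ∀ t ∈ Icc a b, |t| ≤ M := fun t ht =>
      abs_le.mpr ⟨ha.trans ht.1, ht.2.trans hb⟩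
    refine (abs_binomGE_increment_sub_le hX hXn.le (D := ε ^ 3 * C₀) (k := k) hab hK.le
      (by positivity) (fun t ht => hdens t (hmem t ht)) (fun t ht => hL' t (hmem t ht))
      (fun t ht => hL1 t (hmem t ht))).trans ?_
    refine mul_le_mul_of_nonneg_left ?_ hK.le
    have h1 : 0 ≤ (6 / δ + 1) * ε ^ 3 := by positivity
    calc 2 * (ε ^ 3 * C₀) * I = 2 * C₀ * I * ε ^ 3 := by ring
      _ ≤ 2 * C₀ * I * ε ^ 3 + (6 / δ + 1) * ε ^ 3 := by linarith
      _ = D * ε ^ 3 := by rw [hD]; ring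
  obtain ⟨hz1, hz2⟩ := abs_le.mp hz
  refine ⟨⟨(hx0 z hz).le, (hx1 z hz).le⟩, ?_⟩
  rw [mul_assoc]
  refine abs_sub_le_of_relative_bounds hK hη (by positivity) hA0 hA hB0 hB
    (normalCDF_nonneg z) (normalCDF_le_one z) (normalCDF_nonneg (-M))
    ((normalCDF_neg_le hM0).trans (hexpM.le.trans hε4)) (normalCDF_le_one M)
    ((one_sub_normalCDF_le hM0).trans (hexpM.le.trans hε4)) ?_ (hincr z M hz1 hz2 le_rfl)
  rw [sub_sub_cancel]
  exact hincr (-M) z le_rfl hz1 hz2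

/-! ### The limits as solutions of the tail equations -/

theorem lower_mem_and_binomGE_eq_iff {a : ℝ} (h0 : 0 < a) (h1 : a < 1) {n X : ℕ} (hX : 1 ≤ X)
    (hXn : X < n) :
    lower a n X ∈ Icc (0 : ℝ) 1 ∧ ∀ p ∈ Icc (0 : ℝ) 1, (binomGE n X p = a ↔ p = lower a n X) :=
  binomGE_eq_iff_eq_quantile hX hXn.le h0 h1

theorem upper_mem_and_binomLE_eq_iff {a : ℝ} (h0 : 0 < a) (h1 : a < 1) {n X : ℕ}
    (hXn : X < n) :
    upper a n X ∈ Icc (0 : ℝ) 1 ∧ ∀ p ∈ Icc (0 : ℝ) 1, (binomLE n X p = a ↔ p = upper a n X) := by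
  have h := binomGE_eq_iff_eq_quantile (n := n) (X := X + 1) (by omega) hXn (u := 1 - a)
    (by linarith) (by linarith)
  rw [show ((X + 1 : ℕ) : ℝ) = (X : ℝ) + 1 by push_cast; ring,
    show (n : ℝ) - ((X : ℝ) + 1) + 1 = (n : ℝ) - X by ring] at h
  refine ⟨h.1, fun p hp => ?_⟩
  rw [upper, ← h.2 p hp]
  have := binomLE_add_binomGE hXn p
  constructor <;> intro _ <;> linarith

/-- Exchanging successes and failures turns the lower tail equation into the upper one, so only the
lower limit needs an expansion. -/
theorem upper_eq_one_sub_lower {a : ℝ} (h0 : 0 < a) (h1 : a < 1) {n X : ℕ} (hX : 1 ≤ X)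
    (hXn : X < n) : upper a n X = 1 - lower a n (n - X) := by
  obtain ⟨hm, hl⟩ := lower_mem_and_binomGE_eq_iff h0 h1 (n := n) (X := n - X) (by omega) (by omega)
  refine (((upper_mem_and_binomLE_eq_iff h0 h1 hXn).2 _
    ⟨by linarith [hm.2], by linarith [hm.1]⟩).mp ?_).symm
  rw [binomLE_eq_binomGE_one_sub hXn.le, sub_sub_cancel]
  exact (hl _ hm).mpr rfl

theorem normalCDF_zUpper {a : ℝ} (h0 : 0 < a) (h1 : a < 1) : normalCDF (zUpper a) = 1 - a := by
  refine cdf_quantile _ (continuous_cdf_of_singleton _ fun x => ?_) (by linarith) (by linarith)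
  exact gaussianReal_absolutelyContinuous 0 one_ne_zero (by simp)

/-! ### The expansions in terms of the approximate quantile -/

section Powers

variable {n : ℝ}

theorem rpow_neg_half_sq (hn : 0 < n) : (n ^ (-(1 / 2) : ℝ)) ^ 2 = n⁻¹ := by
  rw [← Real.rpow_natCast, ← Real.rpow_mul hn.le, ← Real.rpow_neg_one]
  norm_num

theorem rpow_neg_half_cube (hn : 0 < n) :
    (n ^ (-(1 / 2) : ℝ)) ^ 3 = n ^ (-(3 / 2) : ℝ) := by
  rw [← Real.rpow_natCast, ← Real.rpow_mul hn.le]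
  norm_num

theorem rpow_neg_half_pow_four (hn : 0 < n) : (n ^ (-(1 / 2) : ℝ)) ^ 4 = n ^ (-2 : ℝ) := by
  rw [← Real.rpow_natCast, ← Real.rpow_mul hn.le]
  norm_num

theorem lowerExpRefined_eq_lowerExp_add (hn : 0 < n) (p z : ℝ) :
    lowerExpRefined n p z
      = lowerExp n p z + (n ^ (-(1 / 2) : ℝ)) ^ 3 * (sd p * corr₂ p z) := by
  rw [lowerExpRefined, ← rpow_neg_half_cube hn, ← Real.sqrt_eq_rpow, corr₂, sd]
  ring

theorem lowerExpRefined_eq_approxQuantile (hn : 0 < n) {p : ℝ} (h0 : 0 < p) (h1 : p < 1) (z : ℝ) :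
    lowerExpRefined n p z = approxQuantile (n ^ (-(1 / 2) : ℝ)) p z := by
  have hs := sd_pos h0 h1
  have h : sd p * corr₁ p z = (2 * (1 / 2 - p) * z ^ 2 - (1 + p)) / 3 := by
    rw [corr₁]; field_simp
  rw [lowerExpRefined_eq_lowerExp_add hn, lowerExp, ← Real.sqrt_eq_rpow, mul_inv,
    ← rpow_neg_half_sq hn, approxQuantile, stdQuantile]
  change p - _ * z * sd p + _ + _ = _
  linear_combination (-(n ^ (-(1 / 2) : ℝ)) ^ 2) * h

end Powers

theorem upperExp_eq_one_sub_lowerExp (n p z : ℝ) :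
    upperExp n p z = 1 - lowerExp n (1 - p) z := by
  rw [upperExp, lowerExp, sub_sub_cancel, mul_comm (1 - p) p]
  ring

theorem upperExpRefined_eq_one_sub_lowerExpRefined (n p z : ℝ) :
    upperExpRefined n p z = 1 - lowerExpRefined n (1 - p) z := by
  rw [upperExpRefined, lowerExpRefined, upperExp_eq_one_sub_lowerExp, sub_sub_cancel,
    mul_comm (1 - p) p]
  ring

/-! ### The expansion of the lower limit -/

theorem polyGrowth_approxQuantile {δ : ℝ} (hδ : 0 < δ) : PolyGrowth δ approxQuantile :=
  polyGrowth_snd.add ((polyGrowth_sd.mul PolyGrowth.fst).mul (polyGrowth_stdQuantile hδ))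

/-- Near a fixed point the approximate quantile is Lipschitz in `z` with constant of order `ε`. -/
theorem exists_abs_approxQuantile_sub_le {δ : ℝ} (hδ : 0 < δ) (z : ℝ) :
    ∃ B : ℝ, 0 ≤ B ∧ ∀ ε p : ℝ, 0 < ε → ε ≤ 1 → p ∈ Icc δ (1 - δ) → ∀ w, |w - z| ≤ 1 →
      |approxQuantile ε p w - approxQuantile ε p z| ≤ B * ε * |w - z| := by
  obtain ⟨C, hC, k, h⟩ := polyGrowth_sd.mul
    ((PolyGrowth.const 1).sub (PolyGrowth.fst.mul (polyGrowth_slope hδ)))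
  refine ⟨C * (2 + |z|) ^ k, by positivity, fun ε p hε hε1 hp w hw => ?_⟩
  have hconv := (convex_Icc (z - 1) (z + 1)).norm_image_sub_le_of_norm_hasDerivWithin_le
    (f := approxQuantile ε p) (C := C * (2 + |z|) ^ k * ε) (x := z) (y := w)
    (fun t _ => (hasDerivAt_approxQuantile ε p t).hasDerivWithinAt) (fun t ht => ?_)
    ⟨by linarith, by linarith⟩
    ⟨by linarith [(abs_le.mp hw).1], by linarith [(abs_le.mp hw).2]⟩
  · simpa only [Real.norm_eq_abs] using hconv
  · have ht' : |t| ≤ 1 + |z| := by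
      have h1 : |t - z| ≤ 1 := abs_le.mpr ⟨by linarith [ht.1], by linarith [ht.2]⟩
      have h2 := abs_add_le (t - z) z
      rw [sub_add_cancel] at h2
      linarith
    rw [norm_neg, Real.norm_eq_abs, mul_right_comm, abs_mul, abs_of_pos hε]
    refine mul_le_mul_of_nonneg_right ((h ε p t hε hε1 hp).trans ?_) hε.le
    have ht'' : 1 + |t| ≤ 2 + |z| := by linarith
    gcongr

/-- The constant is the minimum of the normal density on `[z - 1, z + 1]`. It converts an error in
tail probability into a shift of `z`. -/
theorem exists_mul_le_normalCDF_sub (z : ℝ) :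
    ∃ c : ℝ, 0 < c ∧ ∀ h, 0 ≤ h → h ≤ 1 →
      c * h ≤ normalCDF (z + h) - normalCDF z ∧ c * h ≤ normalCDF z - normalCDF (z - h) := by
  obtain ⟨t₀, -, ht₀⟩ := (isCompact_Icc (a := z - 1) (b := z + 1)).exists_isMinOn
    ⟨z, by constructor <;> linarith⟩ continuous_normalPDF.continuousOn
  have key : ∀ x y, z - 1 ≤ x → x ≤ y → y ≤ z + 1 →
      normalPDF t₀ * (y - x) ≤ normalCDF y - normalCDF x := by
    intro x y hx hxy hy
    rw [← integral_normalPDF]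
    have h := intervalIntegral.integral_mono_on (μ := volume) hxy (intervalIntegrable_const (c := normalPDF t₀))
      (continuous_normalPDF.intervalIntegrable x y)
      (fun t ht => ht₀ ⟨hx.trans ht.1, ht.2.trans hy⟩)
    rwa [intervalIntegral.integral_const, smul_eq_mul, mul_comm] at h
  refine ⟨normalPDF t₀, normalPDF_pos t₀, fun h h0 h1 => ⟨?_, ?_⟩⟩
  · simpa using key z (z + h) (by linarith) (by linarith) (by linarith)
  · simpa using key (z - h) z (by linarith) (by linarith) (by linarith)

/-- Shifting `z` by `h = C₁ / c * ε ^ 3` changes the normal tail by at least the approximation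
error. The binomial tails at `z + h` and `z - h` therefore enclose `a`, and monotonicity encloses
the limit between the two approximate quantiles, which are `O(ε * h)` from the centre. -/
theorem exists_abs_lower_sub_approxQuantile_le {a δ : ℝ} (h0 : 0 < a) (h1 : a < 1) (hδ : 0 < δ) :
    ∃ C : ℝ, 0 ≤ C ∧ ∀ n X : ℕ, 1 ≤ X → X < n → (X : ℝ) / n ∈ Icc δ (1 - δ) →
      |lower a n X - approxQuantile ((n : ℝ) ^ (-(1 / 2) : ℝ)) ((X : ℝ) / n) (zUpper a)|
        ≤ C * ((n : ℝ) ^ (-(1 / 2) : ℝ)) ^ 4 := by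
  set z := zUpper a
  have hz : normalCDF z = 1 - a := normalCDF_zUpper h0 h1
  obtain ⟨C₁, hC₁, hev⟩ := exists_abs_binomGE_approxQuantile_sub_le hδ
  obtain ⟨B, hB, hlip⟩ := exists_abs_approxQuantile_sub_le hδ z
  obtain ⟨c, hc, hcdf⟩ := exists_mul_le_normalCDF_sub z
  obtain ⟨C₂, hC₂, k, hbd⟩ := polyGrowth_approxQuantile hδ
  have hsmall : ∀ᶠ ε : ℝ in 𝓝[>] 0, C₁ / c * ε ^ 3 ≤ 1 := by
    have : Tendsto (fun ε : ℝ => C₁ / c * ε ^ 3) (𝓝 0) (𝓝 (C₁ / c * 0 ^ 3)) :=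
      (by fun_prop : Continuous fun ε : ℝ => C₁ / c * ε ^ 3).tendsto 0
    have := this.mono_left (nhdsWithin_le_nhds (s := Ioi 0))
    exact this.eventually_le_const (by simp)
  obtain ⟨u, hu, hsub⟩ := mem_nhdsGT_iff_exists_Ioo_subset.mp
    ((hev.and hsmall).and (tendsto_cutoff.eventually_ge_atTop (|z| + 1)))
  have hu : 0 < u := hu
  -- The first summand serves `ε < u`. The second serves `ε ≥ u`, where both quantities are merely
  -- bounded and `1 ≤ (ε / u) ^ 4`.
  refine ⟨B * (C₁ / c) + (1 + C₂ * (1 + |z|) ^ k) / u ^ 4, by positivity,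
    fun n X hX hXn hp => ?_⟩
  have hn : (0 : ℝ) < n := by exact_mod_cast (by omega : 0 < n)
  have hn1 : (1 : ℝ) ≤ n := by exact_mod_cast (by omega : 1 ≤ n)
  have hε2 := rpow_neg_half_sq hn
  have hε : (0 : ℝ) < (n : ℝ) ^ (-(1 / 2) : ℝ) := Real.rpow_pos_of_pos hn _
  have hε1 : (n : ℝ) ^ (-(1 / 2) : ℝ) ≤ 1 := Real.rpow_le_one_of_one_le_of_nonpos hn1 (by norm_num)
  set ε := (n : ℝ) ^ (-(1 / 2) : ℝ)
  set p := (X : ℝ) / n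
  obtain ⟨hlm, hliff⟩ := lower_mem_and_binomGE_eq_iff h0 h1 hX hXn
  have hleq : binomGE n X (lower a n X) = a := (hliff _ hlm).mpr rfl
  rcases lt_or_ge ε u with hlt | hge
  · obtain ⟨⟨hG, hh1⟩, hM⟩ := hsub ⟨hε, hlt⟩
    have hG := hG n X hX hXn (by rw [hε2]; field_simp) hp
    set h := C₁ / c * ε ^ 3 with hh
    have hh0 : 0 ≤ h := by positivity
    have hch : c * h = C₁ * ε ^ 3 := by rw [hh]; field_simp
    obtain ⟨hcd1, hcd2⟩ := hcdf h hh0 hh1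
    have hsmono := strictMonoOn_binomGE hX hXn.le
    obtain ⟨hm1, hb1⟩ := hG (z + h) ((abs_add_le z h).trans (by rw [abs_of_nonneg hh0]; linarith))
    obtain ⟨hm2, hb2⟩ := hG (z - h) ((abs_sub z h).trans (by rw [abs_of_nonneg hh0]; linarith))
    have hle1 : approxQuantile ε p (z + h) ≤ lower a n X := by
      rw [← hsmono.le_iff_le hm1 hlm, hleq]
      linarith [(abs_le.mp hb1).2]
    have hle2 : lower a n X ≤ approxQuantile ε p (z - h) := by
      rw [← hsmono.le_iff_le hlm hm2, hleq]
      linarith [(abs_le.mp hb2).1]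
    have hl1 := hlip ε p hε hε1 hp (z + h) (by rwa [add_sub_cancel_left, abs_of_nonneg hh0])
    have hl2 := hlip ε p hε hε1 hp (z - h) (by
      rwa [sub_sub_cancel_left, abs_neg, abs_of_nonneg hh0])
    rw [add_sub_cancel_left, abs_of_nonneg hh0] at hl1
    rw [sub_sub_cancel_left, abs_neg, abs_of_nonneg hh0] at hl2
    have hfin : |lower a n X - approxQuantile ε p z| ≤ B * ε * h :=
      abs_le.mpr ⟨by linarith [(abs_le.mp hl1).1], by linarith [(abs_le.mp hl2).2]⟩
    refine hfin.trans ?_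
    have : 0 ≤ (1 + C₂ * (1 + |z|) ^ k) / u ^ 4 * ε ^ 4 := by positivity
    calc B * ε * h = B * (C₁ / c) * ε ^ 4 := by rw [hh]; ring
      _ ≤ B * (C₁ / c) * ε ^ 4 + (1 + C₂ * (1 + |z|) ^ k) / u ^ 4 * ε ^ 4 := by linarith
      _ = _ := by ring
  · have h2 := hbd ε p z hε hε1 hp
    have h3 : |lower a n X| ≤ 1 := abs_le.mpr ⟨by linarith [hlm.1], hlm.2⟩
    have h4 := abs_sub (lower a n X) (approxQuantile ε p z)
    have h5 : 1 + C₂ * (1 + |z|) ^ k ≤ (1 + C₂ * (1 + |z|) ^ k) / u ^ 4 * ε ^ 4 := by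
      rw [div_mul_eq_mul_div, le_div_iff₀ (by positivity)]
      gcongr
    have h6 : 0 ≤ B * (C₁ / c) * ε ^ 4 := by positivity
    rw [add_mul]
    linarith

/-- Both expansions of the lower limit. -/
theorem exists_abs_lower_sub_le {a δ : ℝ} (h0 : 0 < a) (h1 : a < 1) (hδ : 0 < δ) :
    ∃ C : ℝ, ∀ n X : ℕ, 1 ≤ X → X < n → δ ≤ (X : ℝ) / n → (X : ℝ) / n ≤ 1 - δ →
      |lower a n X - lowerExp n ((X : ℝ) / n) (zUpper a)| ≤ C * (n : ℝ) ^ (-(3 / 2) : ℝ) ∧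
      |lower a n X - lowerExpRefined n ((X : ℝ) / n) (zUpper a)| ≤ C * (n : ℝ) ^ (-2 : ℝ) := by
  obtain ⟨C, hC, h⟩ := exists_abs_lower_sub_approxQuantile_le h0 h1 hδ
  obtain ⟨B, hB, k, hb⟩ := polyGrowth_sd.mul (polyGrowth_corr₂ hδ)
  refine ⟨C + B * (1 + |zUpper a|) ^ k, fun n X hX hXn hp hp' => ?_⟩
  have hn : (0 : ℝ) < n := by exact_mod_cast (by omega : 0 < n)
  have hn1 : (1 : ℝ) ≤ n := by exact_mod_cast (by omega : 1 ≤ n)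
  have hε : (0 : ℝ) < (n : ℝ) ^ (-(1 / 2) : ℝ) := Real.rpow_pos_of_pos hn _
  have hε1 : (n : ℝ) ^ (-(1 / 2) : ℝ) ≤ 1 := Real.rpow_le_one_of_one_le_of_nonpos hn1 (by norm_num)
  have hmain := h n X hX hXn ⟨hp, hp'⟩
  rw [← lowerExpRefined_eq_approxQuantile hn (hδ.trans_le hp) (by linarith)] at hmain
  have hcorr := hb _ _ (zUpper a) hε hε1 ⟨hp, hp'⟩
  have href := lowerExpRefined_eq_lowerExp_add hn ((X : ℝ) / n) (zUpper a)
  rw [← rpow_neg_half_pow_four hn, ← rpow_neg_half_cube hn]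
  set ε := (n : ℝ) ^ (-(1 / 2) : ℝ)
  set z := zUpper a
  set p := (X : ℝ) / n
  constructor
  · have h2 : lower a n X - lowerExp n p z
        = (lower a n X - lowerExpRefined n p z) + ε ^ 3 * (sd p * corr₂ p z) := by
      rw [href]; ring
    have h3 : ε ^ 4 ≤ ε ^ 3 := pow_le_pow_of_le_one hε.le hε1 (by norm_num)
    rw [h2]
    calc _ ≤ |lower a n X - lowerExpRefined n p z| + |ε ^ 3 * (sd p * corr₂ p z)| := abs_add_le _ _
      _ ≤ C * ε ^ 3 + ε ^ 3 * (B * (1 + |z|) ^ k) := by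
        rw [abs_mul, abs_of_pos (pow_pos hε 3)]
        exact add_le_add (hmain.trans (by gcongr)) (by gcongr)
      _ = _ := by ring
  · have : 0 ≤ B * (1 + |z|) ^ k * ε ^ 4 := by positivity
    rw [add_mul]
    linarith

end ClopperPearson

/-- `a = α / 2` gives the two-sided `1 - α` Clopper–Pearson interval, `a = α` the one-sided
`1 - α` bounds. The first part says that the beta quantiles are the limits obtained by inverting
the binomial tests; the second part is the expansion, uniformly for `X / n` in `[δ, 1 - δ]`. -/
theorem theorem1 (α : ℝ) (hα0 : 0 < α) (hα1 : α < 1) (a : ℝ) (ha : a = α / 2 ∨ a = α) :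
    (∀ n X : ℕ, 1 ≤ X → X < n →
      (ClopperPearson.lower a n X ∈ Set.Icc (0 : ℝ) 1 ∧
        ∀ p ∈ Set.Icc (0 : ℝ) 1,
          (ClopperPearson.binomGE n X p = a ↔ p = ClopperPearson.lower a n X)) ∧
      (ClopperPearson.upper a n X ∈ Set.Icc (0 : ℝ) 1 ∧
        ∀ p ∈ Set.Icc (0 : ℝ) 1,
          (ClopperPearson.binomLE n X p = a ↔ p = ClopperPearson.upper a n X))) ∧
    (∀ δ : ℝ, 0 < δ → ∃ C : ℝ, ∀ n X : ℕ, 1 ≤ X → X < n →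
      δ ≤ (X : ℝ) / n → (X : ℝ) / n ≤ 1 - δ →
      |ClopperPearson.lower a n X
          - ClopperPearson.lowerExp n ((X : ℝ) / n) (ClopperPearson.zUpper a)|
        ≤ C * (n : ℝ) ^ (-(3 / 2) : ℝ) ∧
      |ClopperPearson.upper a n X
          - ClopperPearson.upperExp n ((X : ℝ) / n) (ClopperPearson.zUpper a)|
        ≤ C * (n : ℝ) ^ (-(3 / 2) : ℝ) ∧
      |ClopperPearson.lower a n X
          - ClopperPearson.lowerExpRefined n ((X : ℝ) / n) (ClopperPearson.zUpper a)|
        ≤ C * (n : ℝ) ^ (-2 : ℝ) ∧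
      |ClopperPearson.upper a n X
          - ClopperPearson.upperExpRefined n ((X : ℝ) / n) (ClopperPearson.zUpper a)|
        ≤ C * (n : ℝ) ^ (-2 : ℝ)) := by
  have ha0 : 0 < a := by rcases ha with rfl | rfl <;> linarith
  have ha1 : a < 1 := by rcases ha with rfl | rfl <;> linarith
  refine ⟨fun n X hX hXn => ⟨ClopperPearson.lower_mem_and_binomGE_eq_iff ha0 ha1 hX hXn,
    ClopperPearson.upper_mem_and_binomLE_eq_iff ha0 ha1 hXn⟩, fun δ hδ => ?_⟩
  obtain ⟨C, hC⟩ := ClopperPearson.exists_abs_lower_sub_le ha0 ha1 hδ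
  refine ⟨C, fun n X hX hXn hp hp1 => ?_⟩
  have hn : (n : ℝ) ≠ 0 := by exact_mod_cast (by omega : n ≠ 0)
  have hsub : ((n - X : ℕ) : ℝ) / n = 1 - (X : ℝ) / n := by
    push_cast [hXn.le]
    field_simp
  obtain ⟨hl, hl1⟩ := hC n X hX hXn hp hp1
  -- The lower bounds at `n - X` give the upper ones at `X`; the range `[δ, 1 - δ]` is symmetric, so
  -- the same constant serves.
  obtain ⟨hu, hu1⟩ := hC n (n - X) (by omega) (by omega) (by rw [hsub]; linarith)
    (by rw [hsub]; linarith)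
  rw [hsub] at hu hu1
  rw [ClopperPearson.upper_eq_one_sub_lower ha0 ha1 hX hXn,
    ClopperPearson.upperExp_eq_one_sub_lowerExp,
    ClopperPearson.upperExpRefined_eq_one_sub_lowerExpRefined, sub_sub_sub_cancel_left,
    sub_sub_sub_cancel_left, abs_sub_comm (ClopperPearson.lowerExp _ _ _),
    abs_sub_comm (ClopperPearson.lowerExpRefined _ _ _)]
  exact ⟨hl, hu, hl1, hu1⟩
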